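/- Let $V$ be a complex vector space with a bilinear form $\sigma$ and a basis $y_1,\dots,y_n$ ($n\ge 0$) such that $\sigma(y_i,y_j)=\delta_{ij}$, and let $x_1,\dots,x_n\in V^*$ be the dual basis. Let $\mathcal W$ be the Weyl algebra of $V\oplus V^*$, i.e. the quotient of the tensor algebra by the relations $vv'-v'v=\omega(v,v')$, where $\omega$ is the symplectic form with $\omega(y,y')=0=\omega(x,x')$ and $\omega(y,x)=x(y)=-\omega(x,y)$ for $y,y'\in V$, $x,x'\in V^*$ (so $[y_i,x_j]=\delta_{ij}$). Let $\mathcal C$ be the Clifford algebra of $(V,\sigma)$, with generators $e_i$ (the images of the $y_i$) satisfying $e_ie_j+e_je_i=2\delta_{ij}$, and let $\mathcal{WC}=\mathcal W\otimes_{\mathbb C}\mathcal C$, with the $\mathbb Z_2$-grading $\mathcal{WC}_{\bar p}=\mathcal W\otimes\mathcal C_{\bar p}$ induced by that of $\mathcal C$ and with the graded commutator $[a,b]=ab-(-1)^{|a||b|}ba$. Let $\mathfrak{spo}(2|1)\subset\mathcal{WC}$ be the Lie sub-superalgebra generated by $\sum_j y_j\otimes e_j$ and $\sum_j x_j\otimes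 e_j$, and let the total angular momentum algebra $\mathfrak O$ be the centralizer of $\mathfrak{spo}(2|1)$ in $\mathcal{WC}$ with respect to the graded commutator, with even part $\mathfrak O_{\bar 0}=\mathfrak O\cap\mathcal{WC}_{\bar 0}$. Put $L_{ij}=x_iy_j-x_jy_i$ and $O_{ij}=L_{ij}+\tfrac12 e_ie_j\in\mathcal{WC}$ for $i<j$. Let $\mathfrak{so}(n,\mathbb C)=\{X\in \mathrm{Mat}_n(\mathbb C)\mid X^T+X=0\}$, and let $X_{ij}=E_{ij}-E_{ji}$. Then there is a unique homomorphism of unital $\mathbb C$-algebras $\mathcal U(\mathfrak{so}(n,\mathbb C))\to\mathfrak O$ that sends $X_{ij}$ to $O_{ij}$ for all $1\le i<j\le n$, and its image is exactly $\mathfrak O_{\bar 0}$. -/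

import Mathlib

noncomputable section

open scoped TensorProduct

namespace AngularMomentum

/-! ### The Weyl algebra -/

section Weyl

variable {M : Type*} [AddCommGroup M] [Module ℂ M]

/-- The relations `v v' - v' v = ω(v, v')` of the Weyl algebra, on the tensor algebra. -/
inductive WeylRel (ω : LinearMap.BilinForm ℂ M) : TensorAlgebra ℂ M → TensorAlgebra ℂ M → Prop
  | comm (v v' : M) : WeylRel ω
      (TensorAlgebra.ι ℂ v * TensorAlgebra.ι ℂ v' - TensorAlgebra.ι ℂ v' * TensorAlgebra.ι ℂ v)
      (algebraMap ℂ (TensorAlgebra ℂ M) (ω v v'))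

/-- The Weyl algebra `T(M) / (v ⊗ v' - v' ⊗ v - ω(v, v'))`. -/
def WeylAlgebra (ω : LinearMap.BilinForm ℂ M) : Type _ := RingQuot (WeylRel ω)

instance (ω : LinearMap.BilinForm ℂ M) : Ring (WeylAlgebra ω) :=
  inferInstanceAs (Ring (RingQuot (WeylRel ω)))

instance (ω : LinearMap.BilinForm ℂ M) : Algebra ℂ (WeylAlgebra ω) :=
  inferInstanceAs (Algebra ℂ (RingQuot (WeylRel ω)))

/-- The canonical linear map from `M` to its Weyl algebra. -/
def WeylAlgebra.ι (ω : LinearMap.BilinForm ℂ M) : M →ₗ[ℂ] WeylAlgebra ω :=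
  (RingQuot.mkAlgHom ℂ (WeylRel ω)).toLinearMap ∘ₗ TensorAlgebra.ι ℂ

end Weyl

variable {V : Type*} [AddCommGroup V] [Module ℂ V]

variable (V) in
/-- The symplectic form on `V ⊕ V*`: `ω(y, x) = ⟨y, x⟩ = -ω(x, y)`, and `V`, `V*` are isotropic. -/
def symplecticForm : LinearMap.BilinForm ℂ (V × Module.Dual ℂ V) :=
  LinearMap.mk₂ ℂ (fun v v' => v'.2 v.1 - v.2 v'.1)
    (fun _ _ _ => by simp; ring) (fun _ _ _ => by simp; ring)
    (fun _ _ _ => by simp; ring) (fun _ _ _ => by simp; ring)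

/-! ### The Weyl-Clifford algebra and its grading -/

/-- The Clifford algebra of `(V, σ)`, in which `v ^ 2 = σ(v, v)`. -/
abbrev Cliff (σ : LinearMap.BilinForm ℂ V) : Type _ := CliffordAlgebra σ.toQuadraticMap

/-- The Weyl-Clifford algebra. -/
abbrev WeylCliff (σ : LinearMap.BilinForm ℂ V) : Type _ :=
  WeylAlgebra (symplecticForm V) ⊗[ℂ] Cliff σ

/-- The homogeneous parts `W ⊗ C_0` and `W ⊗ C_1` of the Weyl-Clifford algebra. -/
def gradedPart (σ : LinearMap.BilinForm ℂ V) (p : ZMod 2) : Submodule ℂ (WeylCliff σ) :=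
  LinearMap.range (LinearMap.lTensor (WeylAlgebra (symplecticForm V))
    (CliffordAlgebra.evenOdd σ.toQuadraticMap p).subtype)

/-- The automorphism of the Weyl-Clifford algebra that is `1` on the even part
and `-1` on the odd part. -/
def parity (σ : LinearMap.BilinForm ℂ V) : WeylCliff σ →ₐ[ℂ] WeylCliff σ :=
  Algebra.TensorProduct.map (AlgHom.id ℂ _) CliffordAlgebra.involute

/-- The projection of the Weyl-Clifford algebra to its odd part. -/
def oddProj (σ : LinearMap.BilinForm ℂ V) : WeylCliff σ →ₗ[ℂ] WeylCliff σ :=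
  (2⁻¹ : ℂ) • (LinearMap.id - (parity σ).toLinearMap)

/-- The graded commutator: the bilinear map that is `a b - (-1) ^ (|a| |b|) b a` on homogeneous
elements (see `superBracket_of_mem`). -/
def superBracket (σ : LinearMap.BilinForm ℂ V) (a b : WeylCliff σ) : WeylCliff σ :=
  a * b - b * a + (2 : ℂ) • (oddProj σ b * oddProj σ a)

theorem parity_of_mem (σ : LinearMap.BilinForm ℂ V) {p : ZMod 2} {a : WeylCliff σ}
    (ha : a ∈ gradedPart σ p) : parity σ a = (-1 : ℂ) ^ p.val • a := by
  obtain ⟨t, rfl⟩ := ha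
  induction t using TensorProduct.induction_on with
  | zero => simp
  | add s t hs ht => rw [map_add, map_add, hs, ht, smul_add]
  | tmul w c =>
    have hc : CliffordAlgebra.involute (c : Cliff σ) = (-1 : ℂ) ^ p.val • (c : Cliff σ) := by
      fin_cases p
      · simpa [ZMod.val] using CliffordAlgebra.involute_eq_of_mem_even c.2
      · simpa [ZMod.val] using CliffordAlgebra.involute_eq_of_mem_odd c.2
    simp [parity, hc]

theorem superBracket_of_mem (σ : LinearMap.BilinForm ℂ V) {p q : ZMod 2} {a b : WeylCliff σ}
    (ha : a ∈ gradedPart σ p) (hb : b ∈ gradedPart σ q) :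
    superBracket σ a b = a * b - (-1 : ℂ) ^ (p.val * q.val) • (b * a) := by
  have h1 := parity_of_mem σ ha
  have h2 := parity_of_mem σ hb
  have e : (2 : ℂ) • (b * a) = b * a + b * a := two_smul ℂ _
  fin_cases p <;> fin_cases q <;>
    simp_all [superBracket, oddProj, ZMod.val, ← two_smul ℂ, smul_smul]
  rw [sub_add, two_smul]
  abel

/-! ### The generators and the total angular momentum algebra -/

section Generators

variable (σ : LinearMap.BilinForm ℂ V) {n : ℕ} (y : Module.Basis (Fin n) ℂ V)

/-- The generator `y_i` of the Weyl algebra. -/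
def wy (i : Fin n) : WeylAlgebra (symplecticForm V) :=
  WeylAlgebra.ι (symplecticForm V) (y i, 0)

/-- The generator `x_i` of the Weyl algebra, from the dual basis of `y`. -/
def wx (i : Fin n) : WeylAlgebra (symplecticForm V) :=
  WeylAlgebra.ι (symplecticForm V) (0, y.coord i)

/-- The generator `e_i` of the Clifford algebra. -/
def ce (i : Fin n) : Cliff σ := CliffordAlgebra.ι σ.toQuadraticMap (y i)

/-- The Dirac operator `∑ y_j ⊗ e_j`. -/
def dirac : WeylCliff σ := ∑ j, wy y j ⊗ₜ[ℂ] ce σ y j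

/-- The dual Dirac operator `∑ x_j ⊗ e_j`. -/
def diracDual : WeylCliff σ := ∑ j, wx y j ⊗ₜ[ℂ] ce σ y j

/-- Lie sub-superalgebras of the Weyl-Clifford algebra: graded subspaces that are closed under the
graded commutator. -/
structure IsLieSubSuperalgebra (S : Submodule ℂ (WeylCliff σ)) : Prop where
  parity_mem : ∀ a ∈ S, parity σ a ∈ S
  bracket_mem : ∀ a ∈ S, ∀ b ∈ S, superBracket σ a b ∈ S

/-- The harmonic Lie superalgebra `spo(2|1)`: the Lie sub-superalgebra generated by the Dirac
operator and its dual. -/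
def spo : Submodule ℂ (WeylCliff σ) :=
  sInf {S | IsLieSubSuperalgebra σ S ∧ dirac σ y ∈ S ∧ diracDual σ y ∈ S}

theorem parity_mem_spo {s : WeylCliff σ} (hs : s ∈ spo σ y) : parity σ s ∈ spo σ y := by
  rw [spo, Submodule.mem_sInf] at hs ⊢
  exact fun S hS => hS.1.parity_mem s (hs S hS)

theorem oddProj_mem_spo {s : WeylCliff σ} (hs : s ∈ spo σ y) : oddProj σ s ∈ spo σ y :=
  Submodule.smul_mem _ _ (Submodule.sub_mem _ hs (parity_mem_spo σ y hs))

theorem parity_parity (a : WeylCliff σ) : parity σ (parity σ a) = a := by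
  have : (parity σ).comp (parity σ) = AlgHom.id ℂ _ := by
    ext <;> simp [parity]
  exact DFunLike.congr_fun this a

theorem oddProj_oddProj (a : WeylCliff σ) : oddProj σ (oddProj σ a) = oddProj σ a := by
  simp only [oddProj, LinearMap.smul_apply, LinearMap.sub_apply, LinearMap.id_apply,
    AlgHom.toLinearMap_apply, map_smul, map_sub, parity_parity]
  module

/-- An element is annihilated by bracketing with `spo(2|1)` iff it commutes with its even elements
and commutes up to parity with its odd elements. -/
theorem superBracket_eq_zero_iff (a : WeylCliff σ) :
    (∀ s ∈ spo σ y, superBracket σ s a = 0) ↔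
      ∀ s ∈ spo σ y, (s - oddProj σ s) * a = a * (s - oddProj σ s) ∧
        oddProj σ s * a = parity σ a * oddProj σ s := by
  have hp : parity σ a = a - (2 : ℂ) • oddProj σ a := by
    simp only [oddProj, LinearMap.smul_apply, LinearMap.sub_apply, LinearMap.id_apply,
      AlgHom.toLinearMap_apply]
    module
  constructor
  · intro h s hs
    have h1 := h _ (oddProj_mem_spo σ y hs)
    have h0 := h _ (Submodule.sub_mem _ hs (oddProj_mem_spo σ y hs))
    simp only [superBracket, map_sub, oddProj_oddProj, sub_self, mul_zero, smul_zero,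
      add_zero] at h0 h1
    refine ⟨sub_eq_zero.mp h0, ?_⟩
    rw [hp, sub_mul, smul_mul_assoc, ← sub_eq_zero, ← h1]
    abel
  · intro h s hs
    obtain ⟨h0, h1⟩ := h s hs
    rw [hp, sub_mul, smul_mul_assoc] at h1
    have : superBracket σ s a = ((s - oddProj σ s) * a - a * (s - oddProj σ s)) +
        (oddProj σ s * a - (a * oddProj σ s - (2 : ℂ) • (oddProj σ a * oddProj σ s))) := by
      rw [superBracket, sub_mul, mul_sub]
      abel
    rw [this, h0, h1]
    abel

/-- The total angular momentum algebra: the centralizer, for the graded commutator, of `spo(2|1)`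
in the Weyl-Clifford algebra. -/
def tama : Subalgebra ℂ (WeylCliff σ) where
  carrier := {a | ∀ s ∈ spo σ y, superBracket σ s a = 0}
  mul_mem' {a b} ha hb := by
    rw [Set.mem_ofPred_eq, superBracket_eq_zero_iff] at *
    intro s hs
    obtain ⟨a0, a1⟩ := ha s hs
    obtain ⟨b0, b1⟩ := hb s hs
    refine ⟨?_, ?_⟩
    · rw [← mul_assoc, a0, mul_assoc, b0, mul_assoc]
    · rw [← mul_assoc, a1, mul_assoc, b1, map_mul, mul_assoc]
  add_mem' {a b} ha hb := by
    rw [Set.mem_ofPred_eq, superBracket_eq_zero_iff] at *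
    intro s hs
    obtain ⟨a0, a1⟩ := ha s hs
    obtain ⟨b0, b1⟩ := hb s hs
    exact ⟨by rw [mul_add, add_mul, a0, b0], by rw [mul_add, map_add, add_mul, a1, b1]⟩
  algebraMap_mem' c := by
    rw [Set.mem_ofPred_eq, superBracket_eq_zero_iff]
    intro s _
    exact ⟨(Algebra.commutes c _).symm, by rw [AlgHom.commutes, Algebra.commutes]⟩

/-- The even part of the total angular momentum algebra. -/
def tamaEven : Submodule ℂ (WeylCliff σ) :=
  Subalgebra.toSubmodule (tama σ y) ⊓ gradedPart σ 0

/-- The angular momentum operator `L_ij = x_i y_j - x_j y_i`. -/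
def angMom (i j : Fin n) : WeylAlgebra (symplecticForm V) :=
  wx y i * wy y j - wx y j * wy y i

/-- The 2-index symmetry `O_ij = L_ij + (1/2) e_i e_j` (for `i ≠ j`). -/
def twoIndex (i j : Fin n) : WeylCliff σ :=
  angMom y i j ⊗ₜ[ℂ] 1 + (2⁻¹ : ℂ) • (1 ⊗ₜ[ℂ] (ce σ y i * ce σ y j))

end Generators

/-- The element `X_ij = E_ij - E_ji` of `so(n, ℂ)`. -/
def soX {n : ℕ} (i j : Fin n) : LieAlgebra.Orthogonal.so (Fin n) ℂ :=
  ⟨Matrix.single i j 1 - Matrix.single j i 1, by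
    rw [LieAlgebra.Orthogonal.mem_so]; simp⟩

end AngularMomentum

end

/-!
Let `D = ∑ y_j e_j` and `D' = ∑ x_j e_j`. An even element of the total angular momentum algebra is
an even element `w` that commutes with `D` and `D'`, hence with their squares `∑ y_j ^ 2` and
`∑ x_j ^ 2`, which generate a copy of `sl(2)`. On an `sl(2)`-invariant `w` of degree `d` in the Weyl
generators, Capelli's identity gives `∑ L_ij Ω_ij w = d (d + 2) / 2 * w` modulo lower degree,
where the Cayley operators `Ω_ij` lower the degree and preserve invariance. By induction on `d`, and
since `L_ij` is `O_ij` up to an element of the even Clifford algebra, `w` is a sum of products `b a`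
with `b` in the even Clifford algebra and `a` in the algebra `A` generated by the `O_ij`.

To get rid of `b`, let `P = 2 - Δ Δ'`, where `Δ` and `Δ'` are the graded commutators with `D` and
`D'`. It is `A`-linear on both sides, it is multiplication by `2` on the centralizer, and it kills
`Δ Δ' c` for all `c` in the even Clifford algebra. For an even word `c` of length `d`, expanding
`P (Δ Δ' c) = 0` expresses `4 d (3 - d) P c` through the values of `P` on shorter words, with
coefficients in `A`. As `d` is even, the factor vanishes only for `d = 0`, so `P` maps the even
Clifford algebra to `A`. Therefore `w = P w / 2` lies in `A`.
-/

noncomputable section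

open scoped TensorProduct Matrix

namespace AngularMomentum

attribute [local instance] LieRing.ofAssociativeRing

/-! ### Twisted commutators and filtrations by word length -/

section TwistedCommutator

variable {K R : Type*} [CommRing K] [Ring R] [Algebra K R]

theorem lie_mul_eq (a b c : R) : ⁅a, b * c⁆ = ⁅a, b⁆ * c + b * ⁅a, c⁆ := by
  simp only [Ring.lie_def]; noncomm_ring

/-- The commutator with `v`, twisted by an endomorphism `α`. If `v` is odd and `α` is the parity
automorphism of a superalgebra then it is the graded commutator with `v`. -/
def twistedLie (α : R →ₐ[K] R) (v : R) : R →ₗ[K] R :=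
  LinearMap.mulLeft K v - LinearMap.mulRight K v ∘ₗ α.toLinearMap

theorem twistedLie_apply (α : R →ₐ[K] R) (v w : R) : twistedLie α v w = v * w - α w * v := rfl

theorem twistedLie_id (v w : R) : twistedLie (AlgHom.id K R) v w = ⁅v, w⁆ := rfl

theorem twistedLie_of_fixed {α : R →ₐ[K] R} {w : R} (hw : α w = w) (v : R) :
    twistedLie α v w = ⁅v, w⁆ := by
  rw [twistedLie_apply, hw, Ring.lie_def]

theorem twistedLie_mul (α : R →ₐ[K] R) (v w z : R) :
    twistedLie α v (w * z) = twistedLie α v w * z + α w * twistedLie α v z := by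
  simp only [twistedLie_apply, map_mul]; noncomm_ring

section Odd

variable {α : R →ₐ[K] R} (hα : Function.Involutive α) {u v : R} (hu : α u = -u)
include hα hu

theorem twistedLie_twistedLie (v w : R) : twistedLie α v (twistedLie α u w) =
    v * u * w - v * α w * u + u * α w * v - w * u * v := by
  simp only [twistedLie_apply, map_sub, map_mul, hα w, hu]; noncomm_ring

theorem twistedLie_twistedLie_add (hv : α v = -v) (w : R) :
    twistedLie α v (twistedLie α u w) + twistedLie α u (twistedLie α v w) =
      ⁅v * u + u * v, w⁆ := by
  rw [twistedLie_twistedLie hα hu, twistedLie_twistedLie hα hv, Ring.lie_def]; noncomm_ring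

theorem twistedLie_twistedLie_self (w : R) :
    twistedLie α u (twistedLie α u w) = ⁅u * u, w⁆ := by
  rw [twistedLie_twistedLie hα hu, Ring.lie_def]; noncomm_ring

end Odd

/-- The space spanned by the products of fewer than `d` elements of `s` with an element of `B`. -/
def wordFiltration (s : Set R) (B : Submodule K R) : ℕ → Submodule K R
  | 0 => ⊥
  | d + 1 => B ⊔ Submodule.span K s * wordFiltration s B d

section WordFiltration

variable {s : Set R} {B N : Submodule K R} {d : ℕ} {w : R}

theorem wordFiltration_succ_le : wordFiltration s B (d + 1) ≤ N ↔
    B ≤ N ∧ ∀ g ∈ s, ∀ w ∈ wordFiltration s B d, g * w ∈ N := by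
  rw [wordFiltration, sup_le_iff, ← Submodule.span_eq (wordFiltration s B d),
    Submodule.span_mul_span, Submodule.span_le, Submodule.span_eq]
  simp only [Set.mul_subset_iff, SetLike.mem_coe]

theorem le_wordFiltration_succ : B ≤ wordFiltration s B (d + 1) := le_sup_left

theorem mul_mem_wordFiltration {g : R} (hg : g ∈ s) (hw : w ∈ wordFiltration s B d) :
    g * w ∈ wordFiltration s B (d + 1) :=
  Submodule.mem_sup_right (Submodule.mul_mem_mul (Submodule.subset_span hg) hw)

theorem wordFiltration_le_succ : wordFiltration s B d ≤ wordFiltration s B (d + 1) := by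
  induction d with
  | zero => exact bot_le
  | succ d ih =>
    exact wordFiltration_succ_le.2
      ⟨le_wordFiltration_succ, fun g hg w hw => mul_mem_wordFiltration hg (ih hw)⟩

theorem wordFiltration_mono : Monotone (wordFiltration s B) :=
  monotone_nat_of_le_succ fun _ => wordFiltration_le_succ

theorem mul_mem_of_mem_adjoin (hN : ∀ g ∈ s, ∀ w ∈ N, g * w ∈ N) {a : R}
    (ha : a ∈ Algebra.adjoin K s) (hw : w ∈ N) : a * w ∈ N := by
  induction ha using Algebra.adjoin_induction generalizing w with
  | mem g hg => exact hN g hg w hw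
  | algebraMap r => rw [← Algebra.smul_def]; exact N.smul_mem r hw
  | add a b _ _ iha ihb => rw [add_mul]; exact N.add_mem (iha hw) (ihb hw)
  | mul a b _ _ iha ihb => rw [mul_assoc]; exact iha (ihb hw)

theorem adjoin_mul_le_iSup_wordFiltration :
    Subalgebra.toSubmodule (Algebra.adjoin K s) * B ≤ ⨆ d, wordFiltration s B d := by
  refine Submodule.mul_le.2 fun a ha b hb => mul_mem_of_mem_adjoin (fun g hg w hw => ?_) ha
    (Submodule.mem_iSup_of_mem 1 (le_wordFiltration_succ hb))
  obtain ⟨d, hd⟩ := (Submodule.mem_iSup_of_directed _ wordFiltration_mono.directed_le).1 hw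
  exact Submodule.mem_iSup_of_mem (d + 1) (mul_mem_wordFiltration hg hd)

theorem exists_mem_wordFiltration
    (hw : w ∈ Subalgebra.toSubmodule (Algebra.adjoin K s) * B) : ∃ d, w ∈ wordFiltration s B d :=
  (Submodule.mem_iSup_of_directed _ wordFiltration_mono.directed_le).1
    (adjoin_mul_le_iSup_wordFiltration hw)

theorem wordFiltration_one_le_adjoin :
    wordFiltration s (1 : Submodule K R) d ≤ Subalgebra.toSubmodule (Algebra.adjoin K s) := by
  induction d with
  | zero => exact bot_le
  | succ d ih =>
    exact wordFiltration_succ_le.2 ⟨Submodule.one_le.2 (Algebra.adjoin K s).one_mem,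
      fun g hg w hw => (Algebra.adjoin K s).mul_mem (Algebra.subset_adjoin hg) (ih hw)⟩

variable {α : R →ₐ[K] R} {ε : K}

theorem smodEq_pow_smul_of_mem_wordFiltration (hs : ∀ g ∈ s, α g = ε • g)
    (hB : ∀ b ∈ B, α b = b) (hw : w ∈ wordFiltration s B (d + 1)) :
    α w ≡ ε ^ d • w [SMOD wordFiltration s B d] := by
  suffices wordFiltration s B (d + 1) ≤
      (wordFiltration s B d).comap (α.toLinearMap - ε ^ d • LinearMap.id) from
    SModEq.sub_mem.2 (this hw)
  induction d generalizing w with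
  | zero =>
    refine wordFiltration_succ_le.2 ⟨fun b hb => ?_, fun g _ w hw => ?_⟩
    · simp [hB b hb]
    · simp [(Submodule.mem_bot K).1 hw]
  | succ d ih =>
    refine wordFiltration_succ_le.2 ⟨fun b hb => ?_, fun g hg w hw => ?_⟩
    · have hb' := le_wordFiltration_succ (s := s) (d := d) hb
      simpa [hB b hb] using sub_mem hb' (Submodule.smul_mem _ (ε ^ (d + 1)) hb')
    · have hgw : α (g * w) - ε ^ (d + 1) • (g * w) = ε • (g * (α w - ε ^ d • w)) := by
        rw [map_mul, hs g hg, mul_sub, smul_sub, smul_mul_assoc, mul_smul_comm, smul_smul,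
          pow_succ']
      change α (g * w) - ε ^ (d + 1) • (g * w) ∈ wordFiltration s B (d + 1)
      rw [hgw]
      exact Submodule.smul_mem _ ε (mul_mem_wordFiltration hg (ih hw hw))

/-- `v` contracts words in `s` with coefficients in `B` if the twisted commutator with `v` kills
the coefficients and takes scalar values on the letters. -/
structure ContractsWords (α : R →ₐ[K] R) (s : Set R) (B : Submodule K R) (v : R) : Prop where
  twistedLie_coeff : ∀ b ∈ B, twistedLie α v b = 0
  twistedLie_letter : ∀ g ∈ s, twistedLie α v g ∈ (1 : Submodule K R)

theorem mul_mem_of_mem_one {r : R} (hr : r ∈ (1 : Submodule K R)) (hw : w ∈ N) : r * w ∈ N := by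
  obtain ⟨c, rfl⟩ := Submodule.mem_one.1 hr
  rw [← Algebra.smul_def]
  exact N.smul_mem c hw

namespace ContractsWords

variable {v : R}

theorem neg (hv : ContractsWords α s B v) : ContractsWords α s B (-v) := by
  have hneg (w : R) : twistedLie α (-v) w = -twistedLie α v w := by
    simp only [twistedLie_apply]; noncomm_ring
  refine ⟨fun b hb => ?_, fun g hg => ?_⟩ <;> rw [hneg]
  · rw [hv.twistedLie_coeff b hb, neg_zero]
  · exact neg_mem (hv.twistedLie_letter g hg)

variable (hv : ContractsWords α s B v) (hs : ∀ g ∈ s, α g = ε • g)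
include hv hs

theorem twistedLie_mem (hw : w ∈ wordFiltration s B (d + 1)) :
    twistedLie α v w ∈ wordFiltration s B d := by
  suffices wordFiltration s B (d + 1) ≤ (wordFiltration s B d).comap (twistedLie α v) from
    this hw
  induction d generalizing w with
  | zero =>
    refine wordFiltration_succ_le.2 ⟨fun b hb => ?_, fun g _ w hw => ?_⟩
    · simp [hv.twistedLie_coeff b hb]
    · simp [(Submodule.mem_bot K).1 hw]
  | succ d ih =>
    refine wordFiltration_succ_le.2 ⟨fun b hb => ?_, fun g hg w hw => ?_⟩
    · simp [hv.twistedLie_coeff b hb]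
    · rw [Submodule.mem_comap, twistedLie_mul, hs g hg, smul_mul_assoc]
      exact add_mem (mul_mem_of_mem_one (hv.twistedLie_letter g hg) hw)
        (Submodule.smul_mem _ _ (mul_mem_wordFiltration hg (ih hw hw)))

theorem twistedLie_mem_self (hw : w ∈ wordFiltration s B d) :
    twistedLie α v w ∈ wordFiltration s B d :=
  hv.twistedLie_mem hs (wordFiltration_le_succ hw)

theorem mul_twistedLie_mem {g : R} (hg : g ∈ s) (hw : w ∈ wordFiltration s B d) :
    g * twistedLie α v w ∈ wordFiltration s B d := by
  cases d with
  | zero => simp [(Submodule.mem_bot K).1 hw]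
  | succ d => exact mul_mem_wordFiltration hg (hv.twistedLie_mem hs hw)

end ContractsWords

end WordFiltration

section Polarization

variable {ι : Type*} [Fintype ι]

/-- The polarization operator `∑ u_a ∂_a`, where `∂_a` is the twisted commutator with `v_a`. -/
def polarization (α : R →ₐ[K] R) (u v : ι → R) : R →ₗ[K] R :=
  ∑ a, LinearMap.mulLeft K (u a) ∘ₗ twistedLie α (v a)

theorem polarization_apply (α : R →ₐ[K] R) (u v : ι → R) (w : R) :
    polarization α u v w = ∑ a, u a * twistedLie α (v a) w := by
  simp [polarization]

variable {α : R →ₐ[K] R} {u v : ι → R} {ε : K}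

theorem polarization_mul (hε : ε * ε = 1) {g : R} (hg : α g = ε • g) (w : R) :
    polarization α u v (g * w) = polarization α u v g * w + g * polarization α u v w +
      ε • ∑ a, twistedLie α (u a) g * twistedLie α (v a) w := by
  simp only [polarization_apply, Finset.sum_mul, Finset.mul_sum, Finset.smul_sum,
    ← Finset.sum_add_distrib]
  refine Finset.sum_congr rfl fun a _ => ?_
  have hswap : ε • u a * g = ε • twistedLie α (u a) g + g * u a := by
    rw [twistedLie_apply, hg, smul_mul_assoc, smul_mul_assoc, smul_sub, smul_smul, hε, one_smul,
      sub_add_cancel]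
  rw [twistedLie_mul, hg, mul_add, smul_mul_assoc, mul_smul_comm, ← mul_assoc (u a) g,
    ← smul_mul_assoc, ← smul_mul_assoc, hswap]
  noncomm_ring

variable {s : Set R} {B : Submodule K R} {d : ℕ} {w : R}

theorem polarization_mem (hs : ∀ g ∈ s, α g = ε • g) (hus : ∀ a, u a ∈ s)
    (hv : ∀ a, ContractsWords α s B (v a)) (hw : w ∈ wordFiltration s B d) :
    polarization α u v w ∈ wordFiltration s B d := by
  rw [polarization_apply]
  exact sum_mem fun a _ => (hv a).mul_twistedLie_mem hs (hus a) hw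

theorem polarization_smodEq (hε : ε * ε = 1) (hs : ∀ g ∈ s, α g = ε • g)
    (hu : ∀ a, ContractsWords α s B (u a)) (hv : ∀ a, ContractsWords α s B (v a)) {μ : K}
    (hμ : ∀ g ∈ s, polarization α u v g = μ • g) (hw : w ∈ wordFiltration s B (d + 1)) :
    polarization α u v w ≡ (d * μ) • w [SMOD wordFiltration s B d] := by
  suffices wordFiltration s B (d + 1) ≤ (wordFiltration s B d).comap
      (polarization α u v - ((d : K) * μ) • LinearMap.id) from SModEq.sub_mem.2 (this hw)
  have hcoeff : ∀ b ∈ B, polarization α u v b = 0 := fun b hb => by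
    simp [polarization_apply, (hv _).twistedLie_coeff b hb]
  induction d generalizing w with
  | zero =>
    refine wordFiltration_succ_le.2 ⟨fun b hb => ?_, fun g _ w hw => ?_⟩
    · simp [hcoeff b hb]
    · simp [(Submodule.mem_bot K).1 hw]
  | succ d ih =>
    refine wordFiltration_succ_le.2 ⟨fun b hb => ?_, fun g hg w hw => ?_⟩
    · simpa [hcoeff b hb] using
        Submodule.smul_mem _ (((d : K) + 1) * μ) (le_wordFiltration_succ (s := s) (d := d) hb)
    have hcontract : ∑ a, twistedLie α (u a) g * twistedLie α (v a) w ∈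
        wordFiltration s B (d + 1) := sum_mem fun a _ =>
      mul_mem_of_mem_one ((hu a).twistedLie_letter g hg) ((hv a).twistedLie_mem_self hs hw)
    have hstep : polarization α u v (g * w) - (((d + 1 : ℕ) : K) * μ) • (g * w) =
        g * (polarization α u v w - ((d : K) * μ) • w) +
          ε • ∑ a, twistedLie α (u a) g * twistedLie α (v a) w := by
      rw [polarization_mul hε (hs g hg), hμ g hg, mul_sub,
        mul_smul_comm, smul_mul_assoc]
      push_cast
      module
    change polarization α u v (g * w) - (((d + 1 : ℕ) : K) * μ) • (g * w) ∈
      wordFiltration s B (d + 1)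
    rw [hstep]
    exact add_mem (mul_mem_wordFiltration hg (ih hw hw)) (Submodule.smul_mem _ ε hcontract)

end Polarization

end TwistedCommutator

/-! ### Invariants of `sl(2)` in a Weyl algebra with coefficients -/

section Weyl

variable {K R ι : Type*} [Field K] [Ring R] [Algebra K R]

theorem polarization_id_add_polarization_id [Fintype ι] (f g : ι → R) (w : R) :
    polarization (.id K R) f g w + polarization (.id K R) g f w =
      ⁅f ⬝ᵥ g, w⁆ + ∑ i, ⁅g i, ⁅f i, w⁆⁆ := by
  simp only [polarization_apply, twistedLie_id, dotProduct, sum_lie, ← Finset.sum_add_distrib]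
  refine Finset.sum_congr rfl fun i _ => ?_
  simp only [Ring.lie_def]; noncomm_ring

theorem ite_mem_one (p : Prop) [Decidable p] : (if p then 1 else 0 : R) ∈ (1 : Submodule K R) := by
  split_ifs
  · exact Submodule.one_le.1 le_rfl
  · exact zero_mem _

theorem sum_lie_lie_mem_wordFiltration [Fintype ι] {s : Set R} {B : Submodule K R} {f g : ι → R}
    (hf : ∀ i, ContractsWords (.id K R) s B (f i)) (hg : ∀ i, ContractsWords (.id K R) s B (g i))
    {d : ℕ} {w : R} (hw : w ∈ wordFiltration s B (d + 1)) :
    ∑ i, ⁅g i, ⁅f i, w⁆⁆ ∈ wordFiltration s B d := by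
  have hid : ∀ z ∈ s, AlgHom.id K R z = (1 : K) • z := fun z _ => (one_smul K z).symm
  exact sum_mem fun i _ => (hg i).twistedLie_mem_self hid ((hf i).twistedLie_mem hid hw)

theorem polarization_id_self_mem_wordFiltration [CharZero K] [Fintype ι] {s : Set R}
    {B : Submodule K R} {f : ι → R} (hf : ∀ i, ContractsWords (.id K R) s B (f i)) {d : ℕ} {w : R}
    (hw : w ∈ wordFiltration s B (d + 1)) (hfw : ⁅f ⬝ᵥ f, w⁆ = 0) :
    polarization (.id K R) f f w ∈ wordFiltration s B d := by
  have htwo : (2 : K) • polarization (.id K R) f f w ∈ wordFiltration s B d := by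
    rw [two_smul, polarization_id_add_polarization_id, hfw, zero_add]
    exact sum_lie_lie_mem_wordFiltration hf hf hw
  exact (Submodule.smul_mem_iff _ two_ne_zero).1 htwo

theorem lie_dotProduct [Fintype ι] (a : R) (f g : ι → R) :
    ⁅a, f ⬝ᵥ g⁆ = ∑ i, (⁅a, f i⁆ * g i + f i * ⁅a, g i⁆) := by
  simp only [dotProduct, lie_sum, lie_mul_eq]

/-- The canonical commutation relations `[y_i, x_j] = δ_ij`. -/
structure WeylRelations [DecidableEq ι] (x y : ι → R) : Prop where
  xx : ∀ i j, x i * x j = x j * x i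
  yy : ∀ i j, y i * y j = y j * y i
  yx : ∀ i j, y i * x j = x j * y i + if i = j then 1 else 0

/-- The angular momentum operator `L_ij`. -/
def angularMomentum (x y : ι → R) (i j : ι) : R := x i * y j - x j * y i

/-- The polarized form of Cayley's `Ω` process: with `∂_f` the commutator with `f`, this is the
`2 × 2` determinant `∂_{y_j} ∂_{x_i} - ∂_{y_i} ∂_{x_j}`. -/
def cayleyOmega (x y : ι → R) (i j : ι) (w : R) : R := ⁅y j, ⁅x i, w⁆⁆ - ⁅y i, ⁅x j, w⁆⁆

theorem sum_angularMomentum_mul_cayleyOmega [Fintype ι] (x y : ι → R) (w : R) :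
    ∑ i, ∑ j, angularMomentum x y i j * cayleyOmega x y i j w =
      2 * ∑ i, ∑ j, x i * y j * cayleyOmega x y i j w := by
  rw [two_mul]
  nth_rw 3 [Finset.sum_comm]
  simp only [← Finset.sum_add_distrib, angularMomentum, cayleyOmega]
  refine Finset.sum_congr rfl fun i _ => Finset.sum_congr rfl fun j _ => ?_
  noncomm_ring

namespace WeylRelations

variable [DecidableEq ι] {x y : ι → R}

theorem swap (h : WeylRelations x y) : WeylRelations y (-x) where
  xx := h.yy
  yy i j := by simp [h.xx i j]
  yx i j := by simp [h.yx j i, eq_comm (a := i)]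

theorem lie_xx (h : WeylRelations x y) (i j : ι) : ⁅x i, x j⁆ = 0 := by
  rw [Ring.lie_def, h.xx, sub_self]

theorem lie_yy (h : WeylRelations x y) (i j : ι) : ⁅y i, y j⁆ = 0 := by
  rw [Ring.lie_def, h.yy, sub_self]

theorem lie_yx (h : WeylRelations x y) (i j : ι) : ⁅y i, x j⁆ = if i = j then 1 else 0 := by
  rw [Ring.lie_def, h.yx, add_sub_cancel_left]

theorem lie_xy (h : WeylRelations x y) (i j : ι) : ⁅x i, y j⁆ = -if i = j then 1 else 0 := by
  rw [← lie_skew, h.lie_yx]; simp only [eq_comm (a := j)]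

theorem lie_y_lie_y (h : WeylRelations x y) (i j : ι) (w : R) :
    ⁅y i, ⁅y j, w⁆⁆ = ⁅y j, ⁅y i, w⁆⁆ := by
  rw [leibniz_lie, h.lie_yy, zero_lie, zero_add]

theorem lie_y_lie_x (h : WeylRelations x y) (i j : ι) (w : R) :
    ⁅y i, ⁅x j, w⁆⁆ = ⁅x j, ⁅y i, w⁆⁆ := by
  rw [leibniz_lie, h.lie_yx, add_eq_right]
  split_ifs with hij
  · exact (Commute.one_left _).lie_eq
  · exact zero_lie _

theorem angularMomentum_swap (h : WeylRelations x y) (i j : ι) :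
    angularMomentum y (-x) i j = angularMomentum x y i j := by
  simp only [angularMomentum, Pi.neg_apply, mul_neg, h.yx, eq_comm (a := j)]
  abel

theorem cayleyOmega_swap (h : WeylRelations x y) (i j : ι) (w : R) :
    cayleyOmega y (-x) i j w = cayleyOmega x y i j w := by
  simp only [cayleyOmega, Pi.neg_apply, neg_lie, h.lie_y_lie_x]
  abel

section Coefficients

variable {B : Submodule K R}

theorem contractsWords_x (h : WeylRelations x y) (hBx : ∀ i, ∀ b ∈ B, Commute (x i) b) (i : ι) :
    ContractsWords (.id K R) (Set.range x ∪ Set.range y) B (x i) where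
  twistedLie_coeff b hb := (hBx i b hb).lie_eq
  twistedLie_letter := by
    rintro _ (⟨j, rfl⟩ | ⟨j, rfl⟩) <;> rw [twistedLie_id]
    · exact h.lie_xx i j ▸ zero_mem _
    · exact h.lie_xy i j ▸ neg_mem (ite_mem_one _)

theorem contractsWords_y (h : WeylRelations x y) (hBy : ∀ i, ∀ b ∈ B, Commute (y i) b) (i : ι) :
    ContractsWords (.id K R) (Set.range x ∪ Set.range y) B (y i) where
  twistedLie_coeff b hb := (hBy i b hb).lie_eq
  twistedLie_letter := by
    rintro _ (⟨j, rfl⟩ | ⟨j, rfl⟩) <;> rw [twistedLie_id]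
    · exact h.lie_yx i j ▸ ite_mem_one _
    · exact h.lie_yy i j ▸ zero_mem _

theorem cayleyOmega_mem (h : WeylRelations x y) (hBx : ∀ i, ∀ b ∈ B, Commute (x i) b)
    (hBy : ∀ i, ∀ b ∈ B, Commute (y i) b) {d : ℕ} {w : R}
    (hw : w ∈ wordFiltration (Set.range x ∪ Set.range y) B (d + 1)) (i j : ι) :
    cayleyOmega x y i j w ∈ wordFiltration (Set.range x ∪ Set.range y) B d := by
  have hid : ∀ z ∈ Set.range x ∪ Set.range y, AlgHom.id K R z = (1 : K) • z :=
    fun z _ => (one_smul K z).symm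
  have hlie (k l : ι) : ⁅y k, ⁅x l, w⁆⁆ ∈ wordFiltration (Set.range x ∪ Set.range y) B d :=
    (h.contractsWords_y hBy k).twistedLie_mem_self hid
      ((h.contractsWords_x hBx l).twistedLie_mem hid hw)
  exact sub_mem (hlie j i) (hlie i j)

end Coefficients

variable [Fintype ι]

theorem lie_dotProduct_y_x (h : WeylRelations x y) (i : ι) : ⁅y ⬝ᵥ y, x i⁆ = 2 * y i := by
  rw [← lie_skew, lie_dotProduct]
  simp [h.lie_xy, two_mul, Finset.sum_add_distrib]

theorem lie_dotProduct_y_y (h : WeylRelations x y) (i : ι) : ⁅y ⬝ᵥ y, y i⁆ = 0 := by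
  rw [← lie_skew, lie_dotProduct]
  simp [h.lie_yy]

theorem lie_dotProduct_y_angularMomentum (h : WeylRelations x y) (i j : ι) :
    ⁅y ⬝ᵥ y, angularMomentum x y i j⁆ = 0 := by
  rw [angularMomentum, lie_sub, lie_mul_eq, lie_mul_eq, h.lie_dotProduct_y_x,
    h.lie_dotProduct_y_x, h.lie_dotProduct_y_y, h.lie_dotProduct_y_y, mul_zero, mul_zero,
    mul_assoc, mul_assoc, h.yy i j, sub_self]

theorem lie_dotProduct_y_cayleyOmega (h : WeylRelations x y) {w : R} (hw : ⁅y ⬝ᵥ y, w⁆ = 0)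
    (i j : ι) : ⁅y ⬝ᵥ y, cayleyOmega x y i j w⁆ = 0 := by
  have hlie (a b : ι) : ⁅y ⬝ᵥ y, ⁅y a, ⁅x b, w⁆⁆⁆ = 2 * ⁅y a, ⁅y b, w⁆⁆ := by
    rw [leibniz_lie, h.lie_dotProduct_y_y, zero_lie, zero_add, leibniz_lie (y ⬝ᵥ y) (x b),
      h.lie_dotProduct_y_x, hw, lie_zero, add_zero, two_mul, two_mul, add_lie, lie_add]
  rw [cayleyOmega, lie_sub, hlie, hlie, h.lie_y_lie_y, sub_self]

theorem lie_dotProduct_x_angularMomentum (h : WeylRelations x y) (i j : ι) :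
    ⁅x ⬝ᵥ x, angularMomentum x y i j⁆ = 0 := by
  simpa only [neg_dotProduct_neg, h.angularMomentum_swap] using
    h.swap.lie_dotProduct_y_angularMomentum i j

theorem lie_dotProduct_x_cayleyOmega (h : WeylRelations x y) {w : R} (hw : ⁅x ⬝ᵥ x, w⁆ = 0)
    (i j : ι) : ⁅x ⬝ᵥ x, cayleyOmega x y i j w⁆ = 0 := by
  simpa only [neg_dotProduct_neg, h.cayleyOmega_swap] using
    h.swap.lie_dotProduct_y_cayleyOmega (by rwa [neg_dotProduct_neg]) i j

theorem lie_dotProduct_dotProduct (h : WeylRelations x y) :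
    ⁅y ⬝ᵥ y, x ⬝ᵥ x⁆ = 4 * (x ⬝ᵥ y) + 2 * Fintype.card ι := by
  have hlie (i : ι) : ⁅y ⬝ᵥ y, x i⁆ * x i + x i * ⁅y ⬝ᵥ y, x i⁆ = 4 * (x i * y i) + 2 * 1 := by
    have hyx := h.yx i i
    rw [if_pos rfl] at hyx
    rw [h.lie_dotProduct_y_x, mul_assoc, hyx]
    noncomm_ring
  rw [lie_dotProduct, Finset.sum_congr rfl fun i _ => hlie i, Finset.sum_add_distrib,
    ← Finset.mul_sum, ← Finset.mul_sum]
  simp [dotProduct]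

theorem lie_dotProduct_x_y_eq_zero [CharZero K] (h : WeylRelations x y) {w : R}
    (hy : ⁅y ⬝ᵥ y, w⁆ = 0) (hx : ⁅x ⬝ᵥ x, w⁆ = 0) : ⁅x ⬝ᵥ y, w⁆ = 0 := by
  have hlie : ⁅4 * (x ⬝ᵥ y) + 2 * (Fintype.card ι : R), w⁆ = 0 := by
    rw [← h.lie_dotProduct_dotProduct, lie_lie, hx, hy, lie_zero, lie_zero, sub_zero]
  have hscalar : 4 * (x ⬝ᵥ y) + 2 * (Fintype.card ι : R) =
      (4 : K) • (x ⬝ᵥ y) + algebraMap K R (2 * Fintype.card ι) := by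
    simp [Algebra.smul_def, map_ofNat]
  rw [hscalar, add_lie, smul_lie, (Algebra.commute_algebraMap_left _ w).lie_eq, add_zero] at hlie
  exact (smul_eq_zero.1 hlie).resolve_left (by norm_num)

theorem capelli (h : WeylRelations x y) (w : R) :
    ∑ i, ∑ j, x i * y j * cayleyOmega x y i j w =
      polarization (.id K R) y y (polarization (.id K R) x x w)
        - polarization (.id K R) x y (polarization (.id K R) y x w)
        - polarization (.id K R) y x w - ∑ i, ⁅y i, ⁅x i, w⁆⁆ := by
  have hxy (i j : ι) : x i * ⁅y i, y j * ⁅x j, w⁆⁆ = x i * y j * ⁅y i, ⁅x j, w⁆⁆ := by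
    rw [lie_mul_eq, h.lie_yy, zero_mul, zero_add, mul_assoc]
  have hyy (i j : ι) : y j * ⁅y j, x i * ⁅x i, w⁆⁆ = x i * y j * ⁅y j, ⁅x i, w⁆⁆ +
      if i = j then y i * ⁅x i, w⁆ + ⁅y i, ⁅x i, w⁆⁆ else 0 := by
    rw [lie_mul_eq, h.lie_yx, mul_add, ← mul_assoc (y j) (x i), h.yx]
    simp only [eq_comm (a := j)]
    split_ifs with hij
    · subst hij; noncomm_ring
    · noncomm_ring
  simp only [polarization_apply, twistedLie_id, cayleyOmega, lie_sum, Finset.mul_sum, hxy,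
    mul_sub, Finset.sum_sub_distrib]
  rw [Finset.sum_comm (f := fun j i => y j * ⁅y j, x i * ⁅x i, w⁆⁆)]
  simp only [hyy, Finset.sum_add_distrib, Finset.sum_ite_eq, Finset.mem_univ, if_true]
  abel

variable {B : Submodule K R} {d : ℕ} {w : R}

section

variable (hBx : ∀ i, ∀ b ∈ B, Commute (x i) b) (hBy : ∀ i, ∀ b ∈ B, Commute (y i) b)
  (hw : w ∈ wordFiltration (Set.range x ∪ Set.range y) B (d + 1))
include hBx hBy hw

theorem polarization_sub_polarization_smodEq (h : WeylRelations x y) :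
    polarization (.id K R) x y w - polarization (.id K R) y x w ≡ (d : K) • w
      [SMOD wordFiltration (Set.range x ∪ Set.range y) B d] := by
  have hx := h.contractsWords_x hBx
  have hy := h.contractsWords_y hBy
  have hsum (z : R) : polarization (.id K R) (Sum.elim x y) (Sum.elim y (-x)) z =
      polarization (.id K R) x y z - polarization (.id K R) y x z := by
    simp only [polarization_apply, twistedLie_id, Fintype.sum_sum_type, Sum.elim_inl,
      Sum.elim_inr, Pi.neg_apply, neg_lie, mul_neg, Finset.sum_neg_distrib, sub_eq_add_neg]
  have hletter : ∀ g ∈ Set.range x ∪ Set.range y,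
      polarization (.id K R) (Sum.elim x y) (Sum.elim y (-x)) g = (1 : K) • g := by
    rintro _ (⟨j, rfl⟩ | ⟨j, rfl⟩)
    · simp [polarization_apply, twistedLie_id, h.lie_yx, h.lie_xx]
    · simp [polarization_apply, twistedLie_id, h.lie_yy, h.lie_xy]
  rw [← hsum, ← mul_one (d : K)]
  exact polarization_smodEq (one_mul 1) (fun g _ => (one_smul K g).symm)
    (Sum.rec hx hy) (Sum.rec hy fun i => (hx i).neg) hletter hw

variable [CharZero K] (h : WeylRelations x y) (hwy : ⁅y ⬝ᵥ y, w⁆ = 0) (hwx : ⁅x ⬝ᵥ x, w⁆ = 0)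
include h hwy hwx

theorem two_smul_polarization_y_x_smodEq :
    (2 : K) • polarization (.id K R) y x w ≡ -(d : K) • w
      [SMOD wordFiltration (Set.range x ∪ Set.range y) B d] := by
  have hsum : polarization (.id K R) x y w + polarization (.id K R) y x w ∈
      wordFiltration (Set.range x ∪ Set.range y) B d := by
    rw [polarization_id_add_polarization_id, h.lie_dotProduct_x_y_eq_zero (K := K) hwy hwx,
      zero_add]
    exact sum_lie_lie_mem_wordFiltration (h.contractsWords_x hBx) (h.contractsWords_y hBy) hw
  have hdiff := SModEq.sub_mem.1 (h.polarization_sub_polarization_smodEq hBx hBy hw)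
  refine SModEq.sub_mem.2 ?_
  convert sub_mem hsum hdiff using 1
  module

theorem two_smul_polarization_x_y_smodEq :
    (2 : K) • polarization (.id K R) x y w ≡ (d : K) • w
      [SMOD wordFiltration (Set.range x ∪ Set.range y) B d] := by
  have hyx := SModEq.sub_mem.1 (h.two_smul_polarization_y_x_smodEq hBx hBy hw hwy hwx)
  have hdiff := SModEq.sub_mem.1 (h.polarization_sub_polarization_smodEq hBx hBy hw)
  refine SModEq.sub_mem.2 ?_
  convert add_mem hyx (Submodule.smul_mem _ (2 : K) hdiff) using 1
  module

theorem two_smul_sum_angularMomentum_mul_cayleyOmega_smodEq :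
    (2 : K) • ∑ i, ∑ j, angularMomentum x y i j * cayleyOmega x y i j w ≡ (d * (d + 2) : K) • w
      [SMOD wordFiltration (Set.range x ∪ Set.range y) B d] := by
  have hid : ∀ z ∈ Set.range x ∪ Set.range y, AlgHom.id K R z = (1 : K) • z :=
    fun z _ => (one_smul K z).symm
  have hx := h.contractsWords_x hBx
  have hy := h.contractsWords_y hBy
  have hyyxx : polarization (.id K R) y y (polarization (.id K R) x x w) ∈
      wordFiltration (Set.range x ∪ Set.range y) B d :=
    polarization_mem hid (by simp) hy (polarization_id_self_mem_wordFiltration hx hw hwx)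
  have hlie := sum_lie_lie_mem_wordFiltration hx hy hw
  have hyx := SModEq.sub_mem.1 (h.two_smul_polarization_y_x_smodEq hBx hBy hw hwy hwx)
  have hxy := SModEq.sub_mem.1 (h.two_smul_polarization_x_y_smodEq hBx hBy hw hwy hwx)
  have hxyyx := polarization_mem (u := x) hid (by simp) hy hyx
  rw [map_sub, map_smul, map_smul] at hxyyx
  refine SModEq.sub_mem.2 ?_
  rw [sum_angularMomentum_mul_cayleyOmega, h.capelli (K := K), two_mul]
  convert sub_mem (add_mem (Submodule.smul_mem _ (4 : K) (sub_mem hyyxx hlie))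
    (Submodule.smul_mem _ (d : K) hxy)) (Submodule.smul_mem _ (2 : K) (add_mem hxyyx hyx)) using 1
  module

end

theorem mem_of_lie_dotProduct_eq_zero [CharZero K] (h : WeylRelations x y)
    (hBx : ∀ i, ∀ b ∈ B, Commute (x i) b) (hBy : ∀ i, ∀ b ∈ B, Commute (y i) b)
    {M : Submodule K R} (hBM : B ≤ M) (hM : ∀ i j, ∀ m ∈ M, angularMomentum x y i j * m ∈ M)
    (hw : w ∈ wordFiltration (Set.range x ∪ Set.range y) B d)
    (hwy : ⁅y ⬝ᵥ y, w⁆ = 0) (hwx : ⁅x ⬝ᵥ x, w⁆ = 0) : w ∈ M := by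
  induction d generalizing w with
  | zero => exact (Submodule.mem_bot K).1 hw ▸ zero_mem M
  | succ d ih =>
    rcases d.eq_zero_or_pos with rfl | hd
    · exact wordFiltration_succ_le.2
        ⟨hBM, fun g _ z hz => by rw [(Submodule.mem_bot K).1 hz, mul_zero]; exact zero_mem M⟩ hw
    have hΩ (i j : ι) : cayleyOmega x y i j w ∈ M :=
      ih (h.cayleyOmega_mem hBx hBy hw i j) (h.lie_dotProduct_y_cayleyOmega hwy i j)
        (h.lie_dotProduct_x_cayleyOmega hwx i j)
    set z := (2 : K) • ∑ i, ∑ j, angularMomentum x y i j * cayleyOmega x y i j w with hz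
    have hzM : z ∈ M := Submodule.smul_mem _ _ <| sum_mem fun i _ => sum_mem fun j _ =>
      hM i j _ (hΩ i j)
    have hlie {a : R} (haw : ⁅a, w⁆ = 0) (haL : ∀ i j, ⁅a, angularMomentum x y i j⁆ = 0)
        (haΩ : ∀ i j, ⁅a, cayleyOmega x y i j w⁆ = 0) : ⁅a, z - (d * (d + 2) : K) • w⁆ = 0 := by
      have haLΩ (i j : ι) : ⁅a, angularMomentum x y i j * cayleyOmega x y i j w⁆ = 0 := by
        rw [lie_mul_eq, haL, haΩ, zero_mul, mul_zero, add_zero]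
      rw [← twistedLie_id (K := K), hz]
      simp only [map_sub, map_smul, map_sum]
      simp only [twistedLie_id, haw, haLΩ, Finset.sum_const_zero, smul_zero, sub_zero]
    have hdiff : z - (d * (d + 2) : K) • w ∈ M :=
      ih (SModEq.sub_mem.1 <|
        h.two_smul_sum_angularMomentum_mul_cayleyOmega_smodEq hBx hBy hw hwy hwx)
        (hlie hwy h.lie_dotProduct_y_angularMomentum (h.lie_dotProduct_y_cayleyOmega hwy))
        (hlie hwx h.lie_dotProduct_x_angularMomentum (h.lie_dotProduct_x_cayleyOmega hwx))
    have hd0 : (d * (d + 2) : K) ≠ 0 := by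
      exact_mod_cast (Nat.mul_pos hd (Nat.succ_pos (d + 1))).ne'
    exact (Submodule.smul_mem_iff M hd0).1 ((Submodule.sub_mem_iff_right M hzM).1 hdiff)

end WeylRelations

end Weyl

/-! ### Twisted commutators in a Clifford algebra -/

section Clifford

variable {K R ι : Type*} [Field K] [Ring R] [Algebra K R] [DecidableEq ι]

/-- The relations `e_i e_j + e_j e_i = 2 δ_ij` of an orthonormal family in a Clifford algebra. -/
def CliffordRelations (e : ι → R) : Prop :=
  ∀ i j, e i * e j + e j * e i = if i = j then 2 else 0

namespace CliffordRelations

variable {e : ι → R} (h : CliffordRelations e)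
include h

theorem mul_eq_sub (i j : ι) : e i * e j = (if i = j then 2 else 0) - e j * e i := by
  rw [← h i j, add_sub_cancel_right]

variable (K) in
theorem mul_self [CharZero K] (i : ι) : e i * e i = 1 := by
  have htwo : (2 : K) • (e i * e i) = (2 : K) • 1 := by
    rw [two_smul, h i i, if_pos rfl, ← one_add_one_eq_two, two_smul]
  exact smul_right_injective R (two_ne_zero (α := K)) htwo

section Odd

variable {α : R →ₐ[K] R} (hα : Function.Involutive α) (he : ∀ i, α (e i) = -e i)
include he

theorem twistedLie_letter (i j : ι) : twistedLie α (e i) (e j) = if i = j then 2 else 0 := by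
  rw [twistedLie_apply, he, neg_mul, sub_neg_eq_add, h]

theorem contractsWords (i : ι) : ContractsWords α (Set.range e) 1 (e i) where
  twistedLie_coeff b hb := by
    obtain ⟨r, rfl⟩ := Submodule.mem_one.1 hb
    rw [twistedLie_apply, AlgHom.commutes, Algebra.commutes, sub_self]
  twistedLie_letter := by
    rintro _ ⟨j, rfl⟩
    rw [h.twistedLie_letter he]
    exact Submodule.mem_one.2 ⟨if i = j then 2 else 0, by
      rw [apply_ite (algebraMap K R), map_ofNat, map_zero]⟩

include hα in
theorem twistedLie_twistedLie_skew (i j : ι) (c : R) :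
    twistedLie α (e i) (twistedLie α (e j) c) = -twistedLie α (e j) (twistedLie α (e i) c) := by
  have hcomm : Commute (if i = j then 2 else 0) c := by
    split_ifs
    · exact Commute.ofNat_left 2 c
    · exact Commute.zero_left c
  rw [eq_neg_iff_add_eq_zero, twistedLie_twistedLie_add hα (he j) (he i), h, hcomm.lie_eq]

variable [Fintype ι]

theorem polarization_letter (j : ι) : polarization α e e (e j) = (2 : K) • e j := by
  simp [polarization_apply, h.twistedLie_letter he, two_smul, mul_two]

include hα in
theorem polarization_polarization (c : R) :
    polarization α e e (polarization α e e c) = (2 : K) • polarization α e e c +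
      ∑ i, ∑ j, e i * e j * twistedLie α (e j) (twistedLie α (e i) c) := by
  have hterm (i j : ι) : e i * twistedLie α (e i) (e j * twistedLie α (e j) c) =
      (if i = j then (2 : K) • (e i * twistedLie α (e i) c) else 0) +
        e i * e j * twistedLie α (e j) (twistedLie α (e i) c) := by
    rw [twistedLie_mul, h.twistedLie_letter he, he, h.twistedLie_twistedLie_skew hα he i j]
    split_ifs with hij
    · subst hij; rw [two_smul]; noncomm_ring
    · noncomm_ring
  simp only [polarization_apply, map_sum]
  rw [Finset.sum_comm]
  simp only [hterm, Finset.sum_add_distrib, Finset.sum_ite_eq, Finset.mem_univ, if_true,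
    Finset.smul_sum]

theorem polarization_smodEq {d : ℕ} {c : R}
    (hc : c ∈ wordFiltration (Set.range e) (1 : Submodule K R) (d + 1)) :
    polarization α e e c ≡ (d * 2 : K) • c
      [SMOD wordFiltration (Set.range e) (1 : Submodule K R) d] :=
  AngularMomentum.polarization_smodEq (ε := (-1 : K)) (by norm_num)
    (Set.forall_mem_range.2 fun i => by rw [he, neg_one_smul K])
    (h.contractsWords he) (h.contractsWords he) (Set.forall_mem_range.2 (h.polarization_letter he))
    hc

end Odd

end CliffordRelations

theorem mem_wordFiltration_of_odd [CharZero K] {α : R →ₐ[K] R} {s : Set R}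
    {B : Submodule K R} (hs : ∀ g ∈ s, α g = -g) (hB : ∀ b ∈ B, α b = b) {d : ℕ} (hd : Odd d)
    {c : R} (hc : c ∈ wordFiltration s B (d + 1)) (hαc : α c = c) : c ∈ wordFiltration s B d := by
  have hs' : ∀ g ∈ s, α g = (-1 : K) • g := fun g hg => by rw [hs g hg, neg_one_smul K]
  have hsmod := SModEq.sub_mem.1 (smodEq_pow_smul_of_mem_wordFiltration hs' hB hc)
  rw [hαc, hd.neg_one_pow, neg_one_smul K, sub_neg_eq_add, ← two_smul K] at hsmod
  exact (Submodule.smul_mem_iff _ two_ne_zero).1 hsmod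

end Clifford

/-! ### The action of `so(n)` by inner derivations -/

section Rotation

variable {K R ι : Type*} [Field K] [Ring R] [Algebra K R] [Fintype ι]

/-- The quadratic element `∑ X_ij f_i g_j`. -/
def quadratic (f g : ι → R) : Matrix ι ι K →ₗ[K] R where
  toFun X := ∑ i, ∑ j, X i j • (f i * g j)
  map_add' X Y := by simp [add_smul, Finset.sum_add_distrib]
  map_smul' r X := by simp [mul_smul, Finset.smul_sum]

theorem quadratic_apply (f g : ι → R) (X : Matrix ι ι K) :
    quadratic f g X = ∑ i, ∑ j, X i j • (f i * g j) := rfl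

theorem quadratic_mul_eq_left (f g : ι → R) (X Y : Matrix ι ι K) :
    quadratic f g (X * Y) = quadratic (fun k => ∑ i, X i k • f i) g Y := by
  simp only [quadratic_apply, Matrix.mul_apply, Finset.sum_smul, Finset.sum_mul, Finset.smul_sum,
    smul_mul_assoc, smul_smul, mul_comm (X _ _)]
  calc
    _ = ∑ i, ∑ k, ∑ l, (Y k l * X i k) • (f i * g l) :=
      Finset.sum_congr rfl fun i _ => Finset.sum_comm
    _ = ∑ k, ∑ i, ∑ l, (Y k l * X i k) • (f i * g l) := Finset.sum_comm
    _ = _ := Finset.sum_congr rfl fun k _ => Finset.sum_comm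

theorem quadratic_mul_eq_right (f g : ι → R) (X Y : Matrix ι ι K) :
    quadratic f g (Y * X) = quadratic f (fun k => ∑ i, X k i • g i) Y := by
  simp only [quadratic_apply, Matrix.mul_apply, Finset.sum_smul, Finset.mul_sum, Finset.smul_sum,
    mul_smul_comm, smul_smul]
  exact Finset.sum_congr rfl fun i _ => Finset.sum_comm

theorem lie_quadratic (a : R) (f g : ι → R) (Y : Matrix ι ι K) :
    ⁅a, quadratic f g Y⁆ =
      quadratic (fun k => ⁅a, f k⁆) g Y + quadratic f (fun k => ⁅a, g k⁆) Y := by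
  simp only [quadratic_apply, ← Finset.sum_add_distrib, ← smul_add, ← lie_mul_eq, lie_sum]
  exact Finset.sum_congr rfl fun i _ => Finset.sum_congr rfl fun j _ =>
    lie_smul (Y i j) a (f i * g j)

theorem lie_quadratic_of_skew {X : Matrix ι ι K} (hX : Xᵀ = -X) {a : R} {f g : ι → R}
    (hf : ∀ k, ⁅a, f k⁆ = ∑ i, X i k • f i) (hg : ∀ k, ⁅a, g k⁆ = ∑ i, X i k • g i)
    (Y : Matrix ι ι K) : ⁅a, quadratic f g Y⁆ = quadratic f g (X * Y - Y * X) := by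
  have hX' (i j : ι) : X i j = (-X) j i := by rw [← hX, Matrix.transpose_apply]
  simp only [lie_quadratic, hf, hg]
  rw [sub_eq_add_neg, ← mul_neg, map_add, quadratic_mul_eq_left, quadratic_mul_eq_right]
  simp only [hX']

theorem quadratic_one [DecidableEq ι] (f g : ι → R) :
    quadratic f g (1 : Matrix ι ι K) = f ⬝ᵥ g := by
  simp [quadratic_apply, Matrix.one_apply, dotProduct]

theorem quadratic_single [DecidableEq ι] (f g : ι → R) (i j : ι) :
    quadratic f g (Matrix.single i j 1 : Matrix ι ι K) = f i * g j := by
  simp [quadratic_apply, Matrix.single_apply, ite_and, ite_smul]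

theorem commute_quadratic {f g : ι → R} {a : R} (hf : ∀ i, Commute a (f i))
    (hg : ∀ i, Commute a (g i)) (X : Matrix ι ι K) : Commute a (quadratic f g X) :=
  Commute.sum_right _ _ _ fun i _ => Commute.sum_right _ _ _ fun j _ =>
    ((hf i).mul_right (hg j)).smul_right _

/-- The element `∑ X_ij (x_i y_j + e_i e_j / 4)` by which a skew-symmetric matrix `X` acts as an
infinitesimal rotation on all three families. -/
def rotation (x y e : ι → R) : Matrix ι ι K →ₗ[K] R :=
  quadratic x y + (4⁻¹ : K) • quadratic e e

theorem rotation_apply (x y e : ι → R) (X : Matrix ι ι K) :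
    rotation x y e X = quadratic x y X + (4⁻¹ : K) • quadratic e e X := rfl

variable [DecidableEq ι] {x y e : ι → R} {X : Matrix ι ι K}

theorem WeylRelations.lie_quadratic_x (h : WeylRelations x y) (X : Matrix ι ι K) (k : ι) :
    ⁅quadratic x y X, x k⁆ = ∑ i, X i k • x i := by
  rw [← lie_skew, lie_quadratic]
  simp [quadratic_apply, h.lie_xx, h.lie_xy]

theorem WeylRelations.lie_quadratic_y (h : WeylRelations x y) (hX : Xᵀ = -X) (k : ι) :
    ⁅quadratic x y X, y k⁆ = ∑ i, X i k • y i := by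
  have hX' (i : ι) : X i k = (-X) k i := by rw [← hX, Matrix.transpose_apply]
  rw [← lie_skew, lie_quadratic]
  simp [quadratic_apply, h.lie_yy, h.lie_yx, hX']

theorem CliffordRelations.lie_quadratic (h : CliffordRelations e) (hX : Xᵀ = -X) (k : ι) :
    ⁅quadratic e e X, e k⁆ = (4 : K) • ∑ i, X i k • e i := by
  have hX' (i : ι) : X k i = -X i k := by
    rw [← neg_eq_iff_eq_neg, ← Matrix.neg_apply, ← hX, Matrix.transpose_apply]
  have hlie (i j : ι) : ⁅e i * e j, e k⁆ =
      (if j = k then (2 : K) • e i else 0) - if i = k then (2 : K) • e j else 0 := by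
    have hcomm : ⁅e i * e j, e k⁆ =
        e i * (e j * e k + e k * e j) - (e i * e k + e k * e i) * e j := by
      rw [Ring.lie_def]; noncomm_ring
    rw [hcomm, h, h]
    split_ifs <;> simp [two_smul, mul_two, two_mul]
  rw [quadratic_apply]
  simp only [sum_lie, smul_lie, hlie, smul_sub, Finset.sum_sub_distrib, smul_ite, smul_zero]
  rw [Finset.sum_comm (f := fun i j => if i = k then X i j • (2 : K) • e j else 0)]
  simp only [Finset.sum_ite_eq', Finset.mem_univ, if_true, hX', neg_smul, Finset.sum_neg_distrib,
    Finset.smul_sum, ← Finset.sum_add_distrib, sub_neg_eq_add]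
  exact Finset.sum_congr rfl fun i _ => by module

/-- The relations of the Weyl-Clifford algebra: the families `x`, `y` generate a Weyl algebra and
`e` generates a Clifford algebra that commutes with it. -/
structure WeylCliffordRelations (x y e : ι → R) : Prop where
  weyl : WeylRelations x y
  clifford : CliffordRelations e
  ex : ∀ i j, Commute (e i) (x j)
  ey : ∀ i j, Commute (e i) (y j)

/-- The two-index symmetry `O_ij = L_ij + e_i e_j / 2`. On the diagonal it is the scalar `1 / 2`. -/
def twoIndexSymmetry (K : Type*) [Field K] [Algebra K R] (x y e : ι → R) (i j : ι) : R :=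
  angularMomentum x y i j + (2⁻¹ : K) • (e i * e j)

namespace WeylCliffordRelations

variable (h : WeylCliffordRelations x y e)
include h

theorem lie_rotation_x (X : Matrix ι ι K) (k : ι) :
    ⁅rotation x y e X, x k⁆ = ∑ i, X i k • x i := by
  have hcomm := (commute_quadratic (fun i => (h.ex i k).symm) (fun i => (h.ex i k).symm) X).symm
  rw [rotation_apply, add_lie, h.weyl.lie_quadratic_x, (hcomm.smul_left _).lie_eq, add_zero]

theorem lie_rotation_y (hX : Xᵀ = -X) (k : ι) :
    ⁅rotation x y e X, y k⁆ = ∑ i, X i k • y i := by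
  have hcomm := (commute_quadratic (fun i => (h.ey i k).symm) (fun i => (h.ey i k).symm) X).symm
  rw [rotation_apply, add_lie, h.weyl.lie_quadratic_y hX, (hcomm.smul_left _).lie_eq, add_zero]

variable [CharZero K]

theorem lie_rotation_e (hX : Xᵀ = -X) (k : ι) :
    ⁅rotation x y e X, e k⁆ = ∑ i, X i k • e i := by
  have hcomm := (commute_quadratic (h.ex k) (h.ey k) X).symm
  rw [rotation_apply, add_lie, hcomm.lie_eq, zero_add, smul_lie, h.clifford.lie_quadratic hX,
    inv_smul_smul₀ (by norm_num)]

theorem lie_rotation_rotation (hX : Xᵀ = -X) (Y : Matrix ι ι K) :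
    ⁅rotation x y e X, rotation x y e Y⁆ = rotation x y e (X * Y - Y * X) := by
  rw [rotation_apply x y e Y, lie_add, lie_smul (4⁻¹ : K) (rotation x y e X) (quadratic e e Y),
    lie_quadratic_of_skew hX (h.lie_rotation_x X) (h.lie_rotation_y hX),
    lie_quadratic_of_skew hX (h.lie_rotation_e hX) (h.lie_rotation_e hX), rotation_apply]

theorem commute_rotation_dirac (hX : Xᵀ = -X) : Commute (rotation x y e X) (y ⬝ᵥ e) := by
  rw [commute_iff_lie_eq, ← quadratic_one (K := K),
    lie_quadratic_of_skew hX (h.lie_rotation_y hX) (h.lie_rotation_e hX), mul_one, one_mul,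
    sub_self, map_zero]

theorem commute_rotation_diracDual (hX : Xᵀ = -X) : Commute (rotation x y e X) (x ⬝ᵥ e) := by
  rw [commute_iff_lie_eq, ← quadratic_one (K := K),
    lie_quadratic_of_skew hX (h.lie_rotation_x X) (h.lie_rotation_e hX), mul_one, one_mul,
    sub_self, map_zero]

theorem twoIndexSymmetry_eq (i j : ι) : twoIndexSymmetry K x y e i j =
    rotation x y e (Matrix.single i j 1 - Matrix.single j i 1 : Matrix ι ι K) +
      algebraMap K R (if i = j then 2⁻¹ else 0) := by
  rw [twoIndexSymmetry, rotation_apply, angularMomentum]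
  simp only [map_sub, quadratic_single]
  split_ifs with hij
  · subst hij
    rw [h.clifford.mul_self K, sub_self, sub_self, smul_zero, zero_add, zero_add, zero_add,
      Algebra.algebraMap_eq_smul_one]
  · rw [h.clifford.mul_eq_sub j i, if_neg (Ne.symm hij), map_zero]
    module

omit [Fintype ι] in
theorem twoIndexSymmetry_mem_adjoin_lt [LinearOrder ι] (i j : ι) : twoIndexSymmetry K x y e i j ∈
    Algebra.adjoin K ((fun p : ι × ι => twoIndexSymmetry K x y e p.1 p.2) '' {p | p.1 < p.2}) := by
  obtain hij | rfl | hji := lt_trichotomy i j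
  · exact Algebra.subset_adjoin ⟨(i, j), hij, rfl⟩
  · rw [twoIndexSymmetry, angularMomentum, sub_self, zero_add, h.clifford.mul_self K,
      ← Algebra.algebraMap_eq_smul_one]
    exact Subalgebra.algebraMap_mem _ _
  · have hswap : twoIndexSymmetry K x y e i j = -twoIndexSymmetry K x y e j i := by
      simp only [twoIndexSymmetry, angularMomentum]
      rw [h.clifford.mul_eq_sub i j, if_neg hji.ne']
      module
    rw [hswap]
    exact neg_mem (Algebra.subset_adjoin ⟨(j, i), hji, rfl⟩)

end WeylCliffordRelations

end Rotation

/-! ### The centralizer of the Dirac operators -/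

section Dirac

section Projection

variable {K R : Type*} [CommRing K] [Ring R] [Algebra K R] {α : R →ₐ[K] R}

theorem map_twistedLie {v : R} (hv : α v = -v) (w : R) :
    α (twistedLie α v w) = -twistedLie α v (α w) := by
  simp only [twistedLie_apply, map_sub, map_mul, hv]; noncomm_ring

/-- The even part of a superalgebra whose parity automorphism is `α`. -/
def evenPart (α : R →ₐ[K] R) : Subalgebra K R := AlgHom.equalizer α (AlgHom.id K R)

theorem mem_evenPart {a : R} : a ∈ evenPart α ↔ α a = a := Iff.rfl

theorem twistedLie_twistedLie_mem_evenPart {u v c : R} (hu : α u = -u) (hv : α v = -v)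
    (hc : c ∈ evenPart α) : twistedLie α u (twistedLie α v c) ∈ evenPart α := by
  rw [mem_evenPart] at hc ⊢
  rw [map_twistedLie hu, map_twistedLie hv, hc, map_neg, neg_neg]

theorem polarization_mem_evenPart {ι : Type*} [Fintype ι] {u v : ι → R} (hu : ∀ i, α (u i) = -u i)
    (hv : ∀ i, α (v i) = -v i) {c : R} (hc : c ∈ evenPart α) :
    polarization α u v c ∈ evenPart α := by
  rw [polarization_apply]
  refine sum_mem fun i _ => ?_
  rw [mem_evenPart, map_mul, map_twistedLie (hv i), hu, mem_evenPart.1 hc, neg_mul_neg]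

/-- The even elements that commute with all elements of `s`. -/
def evenCentralizer (α : R →ₐ[K] R) (s : Set R) : Subalgebra K R :=
  evenPart α ⊓ Subalgebra.centralizer K s

section EvenCentralizer

variable {s : Set R} {a v : R} (ha : a ∈ evenCentralizer α s) (hv : v ∈ s)
include ha hv

theorem commute_of_mem_evenCentralizer : Commute v a := ha.2 v hv

theorem twistedLie_eq_zero_of_mem_evenCentralizer : twistedLie α v a = 0 := by
  rw [twistedLie_of_fixed ha.1, (commute_of_mem_evenCentralizer ha hv).lie_eq]

theorem twistedLie_mul_left_of_mem_evenCentralizer (w : R) :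
    twistedLie α v (a * w) = a * twistedLie α v w := by
  rw [twistedLie_mul, twistedLie_eq_zero_of_mem_evenCentralizer ha hv, zero_mul, zero_add,
    mem_evenPart.1 ha.1]

theorem twistedLie_mul_right_of_mem_evenCentralizer (w : R) :
    twistedLie α v (w * a) = twistedLie α v w * a := by
  rw [twistedLie_mul, twistedLie_eq_zero_of_mem_evenCentralizer ha hv, mul_zero, add_zero]

end EvenCentralizer

/-- Twice the truncation `1 - Δ_u Δ_v / 2` of the extremal projector of the superalgebra generated
by the odd elements `u` and `v`, where `Δ` is the twisted commutator. -/
def diracProjection (α : R →ₐ[K] R) (u v : R) : R →ₗ[K] R :=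
  (2 : K) • LinearMap.id - twistedLie α u ∘ₗ twistedLie α v

theorem diracProjection_apply (u v w : R) :
    diracProjection α u v w = (2 : K) • w - twistedLie α u (twistedLie α v w) := rfl

section EvenCentralizer

variable {u v a : R} (ha : a ∈ evenCentralizer α {u, v})
include ha

theorem diracProjection_of_mem_evenCentralizer : diracProjection α u v a = (2 : K) • a := by
  rw [diracProjection_apply, twistedLie_eq_zero_of_mem_evenCentralizer ha (by simp), map_zero,
    sub_zero]

theorem diracProjection_mul_left (w : R) :
    diracProjection α u v (a * w) = a * diracProjection α u v w := by
  rw [diracProjection_apply, twistedLie_mul_left_of_mem_evenCentralizer ha (by simp),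
    twistedLie_mul_left_of_mem_evenCentralizer ha (by simp), ← mul_smul_comm, ← mul_sub,
    diracProjection_apply]

theorem diracProjection_mul_right (w : R) :
    diracProjection α u v (w * a) = diracProjection α u v w * a := by
  rw [diracProjection_apply, twistedLie_mul_right_of_mem_evenCentralizer ha (by simp),
    twistedLie_mul_right_of_mem_evenCentralizer ha (by simp), ← smul_mul_assoc, ← sub_mul,
    diracProjection_apply]

end EvenCentralizer

theorem diracProjection_twistedLie_twistedLie (hα : Function.Involutive α) {u v c : R}
    (hu : α u = -u) (hv : α v = -v) (huv : ⁅u, v * v⁆ = 2 * v) (hc : α c = c)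
    (hcv : Commute (v * v) c) (hcuv : Commute (u * v + v * u) c) :
    diracProjection α u v (twistedLie α u (twistedLie α v c)) = 0 := by
  have hvv : twistedLie α v (twistedLie α v c) = 0 := by
    rw [twistedLie_twistedLie_self hα hv, hcv.lie_eq]
  have hlie : ⁅u * v + v * u, v⁆ = 2 * v := by
    rw [← huv, Ring.lie_def, Ring.lie_def]; noncomm_ring
  have hvuv : twistedLie α v (twistedLie α u (twistedLie α v c)) = (2 : K) • twistedLie α v c := by
    have hadd := twistedLie_twistedLie_add hα hv hu (twistedLie α v c)
    rw [hvv, map_zero, zero_add, twistedLie_of_fixed hc, leibniz_lie, hcuv.lie_eq, lie_zero,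
      add_zero, hlie] at hadd
    rw [twistedLie_of_fixed hc, hadd, two_mul, add_lie, two_smul]
  rw [diracProjection_apply, hvuv, map_smul, sub_self]

end Projection

variable {K R ι : Type*} [Field K] [Ring R] [Algebra K R]

/-- `α` is a parity automorphism for which the families `x`, `y` are even and `e` is odd. -/
structure IsParity (α : R →ₐ[K] R) (x y e : ι → R) : Prop where
  involutive : Function.Involutive α
  x : ∀ i, α (x i) = x i
  y : ∀ i, α (y i) = y i
  e : ∀ i, α (e i) = -e i

namespace IsParity

variable {α : R →ₐ[K] R} {x y e : ι → R} (hα : IsParity α x y e) {w : R}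
include hα

theorem mem_evenPart_of_mem_adjoin (hw : w ∈ Algebra.adjoin K (Set.range x ∪ Set.range y)) :
    w ∈ evenPart α :=
  Algebra.adjoin_le (Set.union_subset (Set.range_subset_iff.2 hα.x) (Set.range_subset_iff.2 hα.y))
    hw

theorem map_mem_adjoin (hw : w ∈ Algebra.adjoin K (Set.range e)) :
    α w ∈ Algebra.adjoin K (Set.range e) := by
  suffices Algebra.adjoin K (Set.range e) ≤ (Algebra.adjoin K (Set.range e)).comap α from this hw
  refine Algebra.adjoin_le (Set.range_subset_iff.2 fun i => ?_)
  rw [SetLike.mem_coe, Subalgebra.mem_comap, hα.e]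
  exact neg_mem (Algebra.subset_adjoin ⟨i, rfl⟩)

theorem mul_mem_adjoin_inf_evenPart (i j : ι) :
    e i * e j ∈ Algebra.adjoin K (Set.range e) ⊓ evenPart α :=
  ⟨mul_mem (Algebra.subset_adjoin ⟨i, rfl⟩) (Algebra.subset_adjoin ⟨j, rfl⟩),
    mem_evenPart.2 (by rw [map_mul, hα.e, hα.e, neg_mul_neg])⟩

end IsParity

theorem angularMomentum_mul_mem {x y e : ι → R} {A E : Subalgebra K R}
    (hO : ∀ i j, twoIndexSymmetry K x y e i j ∈ A) (hEe : ∀ i j, e i * e j ∈ E)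
    (hEx : ∀ i, ∀ b ∈ E, Commute (x i) b) (hEy : ∀ i, ∀ b ∈ E, Commute (y i) b) (i j : ι) {m : R}
    (hm : m ∈ Subalgebra.toSubmodule E * Subalgebra.toSubmodule A) :
    angularMomentum x y i j * m ∈ Subalgebra.toSubmodule E * Subalgebra.toSubmodule A := by
  induction hm using Submodule.mul_induction_on' with
  | mem_mul_mem b hb a ha =>
    have hcomm : Commute (angularMomentum x y i j) b :=
      ((hEx i b hb).mul_left (hEy j b hb)).sub_left ((hEx j b hb).mul_left (hEy i b hb))
    have hL : angularMomentum x y i j * (b * a) =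
        b * (twoIndexSymmetry K x y e i j * a) - (2⁻¹ : K) • ((b * (e i * e j)) * a) := by
      rw [← mul_assoc, hcomm.eq, twoIndexSymmetry, add_mul, mul_add, smul_mul_assoc,
        mul_smul_comm, mul_assoc, mul_assoc b (e i * e j) a, add_sub_cancel_right]
    rw [hL]
    exact sub_mem (Submodule.mul_mem_mul hb (A.mul_mem (hO i j) ha))
      (Submodule.smul_mem _ _ (Submodule.mul_mem_mul (E.mul_mem hb (hEe i j)) ha))
  | add m _ m' _ hm hm' => rw [mul_add]; exact add_mem hm hm'

theorem mem_mul_inf_evenPart [CharZero K] {α : R →ₐ[K] R} (hα : Function.Involutive α)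
    {W C : Submodule K R} (hW : W ≤ Subalgebra.toSubmodule (evenPart α)) (hC : ∀ c ∈ C, α c ∈ C)
    {w : R} (hw : w ∈ evenPart α) (hwC : w ∈ W * C) :
    w ∈ W * (C ⊓ Subalgebra.toSubmodule (evenPart α)) := by
  have hsum {z : R} (hz : z ∈ W * C) : z + α z ∈ W * (C ⊓ Subalgebra.toSubmodule (evenPart α)) := by
    induction hz using Submodule.mul_induction_on' with
    | mem_mul_mem a ha c hc =>
      have hc' : c + α c ∈ evenPart α := by
        rw [mem_evenPart, map_add, hα c, add_comm]
      rw [map_mul, mem_evenPart.1 (hW ha), ← mul_add]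
      exact Submodule.mul_mem_mul ha ⟨add_mem hc (hC c hc), hc'⟩
    | add z _ z' _ hz hz' => rw [map_add, add_add_add_comm]; exact add_mem hz hz'
  have htwo := hsum hwC
  rw [mem_evenPart.1 hw, ← two_smul K] at htwo
  exact (Submodule.smul_mem_iff _ two_ne_zero).1 htwo

variable [Fintype ι]

theorem twistedLie_dotProduct {α : R →ₐ[K] R} {f e : ι → R} {w : R}
    (hfw : ∀ i, Commute (f i) (α w)) :
    twistedLie α (f ⬝ᵥ e) w = ∑ i, f i * twistedLie α (e i) w := by
  simp only [twistedLie_apply, dotProduct, Finset.sum_mul, Finset.mul_sum, mul_sub,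
    ← Finset.sum_sub_distrib, ← mul_assoc, (hfw _).eq]

theorem dotProduct_mul_dotProduct_add {f g e : ι → R} (hf : ∀ i j, Commute (e i) (f j))
    (hg : ∀ i j, Commute (e i) (g j)) :
    (f ⬝ᵥ e) * (g ⬝ᵥ e) + (g ⬝ᵥ e) * (f ⬝ᵥ e) =
      ∑ i, ∑ j, (f i * g j * (e i * e j + e j * e i) - ⁅f i, g j⁆ * (e j * e i)) := by
  have hfg (i j : ι) : f i * e i * (g j * e j) = f i * g j * (e i * e j) := by
    rw [mul_assoc, ← mul_assoc (e i), (hg i j).eq]; noncomm_ring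
  have hgf (i j : ι) : g j * e j * (f i * e i) = g j * f i * (e j * e i) := by
    rw [mul_assoc, ← mul_assoc (e j), (hf j i).eq]; noncomm_ring
  simp only [dotProduct, Finset.sum_mul_sum]
  rw [Finset.sum_comm (f := fun i j => g i * e i * (f j * e j))]
  simp only [← Finset.sum_add_distrib]
  refine Finset.sum_congr rfl fun i _ => Finset.sum_congr rfl fun j _ => ?_
  rw [hfg, hgf, Ring.lie_def]
  noncomm_ring

theorem CliffordRelations.dotProduct_mul_self (K : Type*) [Field K] [Algebra K R] [CharZero K]
    [DecidableEq ι] {e f : ι → R} (h : CliffordRelations e) (hf : ∀ i j, Commute (e i) (f j))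
    (hff : ∀ i j, ⁅f i, f j⁆ = 0) : (f ⬝ᵥ e) * (f ⬝ᵥ e) = f ⬝ᵥ f := by
  have htwo : (2 : K) • ((f ⬝ᵥ e) * (f ⬝ᵥ e)) = (2 : K) • (f ⬝ᵥ f) := by
    rw [two_smul, dotProduct_mul_dotProduct_add hf hf, dotProduct, Finset.smul_sum]
    simp only [hff, h _ _, mul_ite, mul_zero, zero_mul, sub_zero, Finset.sum_ite_eq,
      Finset.mem_univ, if_true, mul_two, two_smul]
  exact smul_right_injective R (two_ne_zero (α := K)) htwo

namespace WeylCliffordRelations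

variable [DecidableEq ι] {x y e : ι → R} (h : WeylCliffordRelations x y e)
include h

theorem dirac_mul_diracDual_add (K : Type*) [Field K] [Algebra K R] [CharZero K] :
    (y ⬝ᵥ e) * (x ⬝ᵥ e) + (x ⬝ᵥ e) * (y ⬝ᵥ e) = 2 * (x ⬝ᵥ y) + Fintype.card ι := by
  rw [add_comm, dotProduct_mul_dotProduct_add h.ex h.ey]
  simp [h.weyl.lie_xy, h.clifford _ _, h.clifford.mul_self K, ite_mul, Finset.sum_add_distrib,
    mul_two, two_mul, dotProduct]

theorem lie_dirac_dotProduct : ⁅y ⬝ᵥ e, x ⬝ᵥ x⁆ = 2 * (x ⬝ᵥ e) := by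
  have hcomm (i : ι) : Commute (x ⬝ᵥ x) (e i) :=
    Commute.sum_left _ _ _ fun j _ => ((h.ex i j).mul_right (h.ex i j)).symm
  have hlie (i : ι) : ⁅x ⬝ᵥ x, y i⁆ = -(2 * x i) := by
    simpa using h.weyl.swap.lie_dotProduct_y_x i
  rw [← lie_skew, lie_dotProduct]
  simp only [hlie, (hcomm _).lie_eq, mul_zero, add_zero, neg_mul, Finset.sum_neg_distrib, neg_neg,
    mul_assoc, ← Finset.mul_sum]
  rfl

variable {α : R →ₐ[K] R} (hα : IsParity α x y e)
include hα

theorem rotation_mem_evenCentralizer [CharZero K] {X : Matrix ι ι K} (hX : Xᵀ = -X) :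
    rotation x y e X ∈ evenCentralizer α {y ⬝ᵥ e, x ⬝ᵥ e} := by
  refine ⟨?_, ?_⟩
  · change α (rotation x y e X) = rotation x y e X
    simp [rotation_apply, quadratic_apply, hα.x, hα.y, hα.e]
  · rintro v (rfl | rfl)
    · exact (h.commute_rotation_dirac hX).symm
    · exact (h.commute_rotation_diracDual hX).symm

theorem twoIndexSymmetry_mem_evenCentralizer [CharZero K] (i j : ι) :
    twoIndexSymmetry K x y e i j ∈ evenCentralizer α {y ⬝ᵥ e, x ⬝ᵥ e} := by
  rw [h.twoIndexSymmetry_eq]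
  exact add_mem (h.rotation_mem_evenCentralizer hα (by simp)) (Subalgebra.algebraMap_mem _ _)

section Reduction

variable {c : R} (hxc : ∀ i, Commute (x i) c) (hyc : ∀ i, Commute (y i) c)
include hxc hyc

theorem twistedLie_dirac_diracDual : twistedLie α (y ⬝ᵥ e) (twistedLie α (x ⬝ᵥ e) c) =
    polarization α e e c +
      ∑ j, ∑ k, x j * y k * twistedLie α (e k) (twistedLie α (e j) c) := by
  have hxc' (i : ι) : Commute (x i) (α c) := hα.x i ▸ (hxc i).map α
  have hyc' (i : ι) : Commute (y i) (α c) := hα.y i ▸ (hyc i).map α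
  have hlie (j : ι) : twistedLie α (y ⬝ᵥ e) (x j) = e j := by
    rw [twistedLie_of_fixed (hα.x j), ← lie_skew, lie_dotProduct]
    simp [h.weyl.lie_xy, (h.ex _ j).symm.lie_eq]
  have hcomm (j k : ι) : Commute (y k) (α (twistedLie α (e j) c)) := by
    rw [map_twistedLie (hα.e j), twistedLie_apply, hα.involutive c]
    exact (((h.ey j k).symm.mul_right (hyc' k)).sub_right
      ((hyc k).mul_right (h.ey j k).symm)).neg_right
  rw [twistedLie_dotProduct hxc', map_sum, polarization_apply, ← Finset.sum_add_distrib]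
  refine Finset.sum_congr rfl fun j _ => ?_
  rw [twistedLie_mul, hlie, hα.x, twistedLie_dotProduct (hcomm j), Finset.mul_sum]
  simp only [mul_assoc]

variable [CharZero K]

theorem four_smul_twistedLie_dirac_diracDual :
    (4 : K) • twistedLie α (y ⬝ᵥ e) (twistedLie α (x ⬝ᵥ e) c) =
      (6 : K) • polarization α e e c - polarization α e e (polarization α e e c) +
      (2 : K) • ∑ j, ∑ k, twoIndexSymmetry K x y e j k *
        twistedLie α (e k) (twistedLie α (e j) c) := by
  have hsplit : ∑ j, ∑ k, twoIndexSymmetry K x y e j k *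
        twistedLie α (e k) (twistedLie α (e j) c) =
      (2 : K) • ∑ j, ∑ k, x j * y k * twistedLie α (e k) (twistedLie α (e j) c) +
        (2⁻¹ : K) • ∑ j, ∑ k, e j * e k * twistedLie α (e k) (twistedLie α (e j) c) := by
    rw [two_smul]
    nth_rw 3 [Finset.sum_comm]
    simp only [Finset.smul_sum, ← Finset.sum_add_distrib]
    refine Finset.sum_congr rfl fun j _ => Finset.sum_congr rfl fun k _ => ?_
    rw [h.clifford.twistedLie_twistedLie_skew hα.involutive hα.e j k, twoIndexSymmetry,
      angularMomentum, add_mul, sub_mul, smul_mul_assoc, mul_neg, sub_eq_add_neg]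
  rw [hsplit, h.twistedLie_dirac_diracDual hα hxc hyc,
    h.clifford.polarization_polarization hα.involutive hα.e]
  module

theorem diracProjection_twistedLie_dirac_diracDual (hc : α c = c) :
    diracProjection α (y ⬝ᵥ e) (x ⬝ᵥ e)
      (twistedLie α (y ⬝ᵥ e) (twistedLie α (x ⬝ᵥ e) c)) = 0 := by
  have hodd {z : ι → R} (hz : ∀ i, α (z i) = z i) : α (z ⬝ᵥ e) = -(z ⬝ᵥ e) := by
    simp [dotProduct, hz, hα.e]
  have hdot {f g : ι → R} (hf : ∀ i, Commute (f i) c) (hg : ∀ i, Commute (g i) c) :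
      Commute (f ⬝ᵥ g) c :=
    Commute.sum_left _ _ _ fun i _ => (hf i).mul_left (hg i)
  refine diracProjection_twistedLie_twistedLie hα.involutive (hodd hα.y) (hodd hα.x) ?_ hc ?_ ?_
  · rw [h.clifford.dotProduct_mul_self K h.ex h.weyl.lie_xx, h.lie_dirac_dotProduct]
  · rw [h.clifford.dotProduct_mul_self K h.ex h.weyl.lie_xx]
    exact hdot hxc hxc
  · rw [h.dirac_mul_diracDual_add K]
    exact ((Commute.ofNat_left 2 c).mul_left (hdot hxc hyc)).add_left (Nat.cast_commute _ c)

theorem smul_diracProjection_eq (hc : α c = c) {μ : K} {r : R}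
    (hr : polarization α e e c = μ • c + r) :
    (μ * (6 - μ)) • diracProjection α (y ⬝ᵥ e) (x ⬝ᵥ e) c =
      diracProjection α (y ⬝ᵥ e) (x ⬝ᵥ e) (polarization α e e r) +
      (μ - 6) • diracProjection α (y ⬝ᵥ e) (x ⬝ᵥ e) r -
      (2 : K) • ∑ j, ∑ k, twoIndexSymmetry K x y e j k *
        diracProjection α (y ⬝ᵥ e) (x ⬝ᵥ e) (twistedLie α (e k) (twistedLie α (e j) c)) := by
  have hzero := congrArg (diracProjection α (y ⬝ᵥ e) (x ⬝ᵥ e))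
    (h.four_smul_twistedLie_dirac_diracDual (K := K) hα hxc hyc)
  simp only [hr, map_add, map_sub, map_smul, map_sum,
    h.diracProjection_twistedLie_dirac_diracDual hα hxc hyc hc,
    diracProjection_mul_left (h.twoIndexSymmetry_mem_evenCentralizer hα _ _)] at hzero
  linear_combination (norm := module) -hzero

end Reduction

variable [CharZero K] {A : Subalgebra K R} {d : ℕ} {c : R}

theorem diracProjection_mem_of_even (hO : ∀ i j, twoIndexSymmetry K x y e i j ∈ A) (hd : Even d)
    (hd0 : d ≠ 0) (hA : ∀ c' ∈ evenPart α, c' ∈ wordFiltration (Set.range e) (1 : Submodule K R) d →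
      diracProjection α (y ⬝ᵥ e) (x ⬝ᵥ e) c' ∈ A)
    (hc : c ∈ evenPart α) (hcd : c ∈ wordFiltration (Set.range e) (1 : Submodule K R) (d + 1)) :
    diracProjection α (y ⬝ᵥ e) (x ⬝ᵥ e) c ∈ A := by
  have hodd : ∀ g ∈ Set.range e, α g = (-1 : K) • g :=
    Set.forall_mem_range.2 fun i => by rw [hα.e, neg_one_smul K]
  have hcontract (i : ι) := h.clifford.contractsWords (K := K) hα.e i
  have hcomm {v : R} (hv : ∀ i, Commute (e i) v) : Commute v c :=
    Algebra.commute_of_mem_adjoin_of_forall_mem_commute (wordFiltration_one_le_adjoin hcd)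
      (Set.forall_mem_range.2 fun i => (hv i).symm)
  obtain ⟨r, hr⟩ : ∃ r, polarization α e e c = (d * 2 : K) • c + r :=
    ⟨_, (add_sub_cancel _ _).symm⟩
  have hr' := eq_sub_iff_add_eq'.2 hr.symm
  have hr_even : r ∈ evenPart α := hr' ▸
    sub_mem (polarization_mem_evenPart hα.e hα.e hc) (Subalgebra.smul_mem _ hc _)
  have hrd : r ∈ wordFiltration (Set.range e) (1 : Submodule K R) d := hr' ▸
    SModEq.sub_mem.1 (h.clifford.polarization_smodEq hα.e hcd)
  have hcontractions : ∑ j, ∑ k, twoIndexSymmetry K x y e j k *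
      diracProjection α (y ⬝ᵥ e) (x ⬝ᵥ e) (twistedLie α (e k) (twistedLie α (e j) c)) ∈ A :=
    sum_mem fun j _ => sum_mem fun k _ => A.mul_mem (hO j k) (hA _
      (twistedLie_twistedLie_mem_evenPart (hα.e k) (hα.e j) hc)
      ((hcontract k).twistedLie_mem_self hodd ((hcontract j).twistedLie_mem hodd hcd)))
  have hmem : (d * 2 * (6 - d * 2) : K) • diracProjection α (y ⬝ᵥ e) (x ⬝ᵥ e) c ∈ A := by
    rw [h.smul_diracProjection_eq hα (fun i => hcomm fun j => h.ex j i)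
      (fun i => hcomm fun j => h.ey j i) hc hr]
    exact sub_mem (add_mem
      (hA _ (polarization_mem_evenPart hα.e hα.e hr_even)
        (polarization_mem hodd Set.mem_range_self hcontract hrd))
      (A.smul_mem (hA r hr_even hrd) _)) (A.smul_mem hcontractions _)
  have hne : (d * 2 * (6 - d * 2) : K) ≠ 0 := by
    have hd3 : 6 ≠ d * 2 := by grind
    exact mul_ne_zero (by exact_mod_cast mul_ne_zero hd0 two_ne_zero)
      (sub_ne_zero.2 (by exact_mod_cast hd3))
  exact (Submodule.smul_mem_iff (Subalgebra.toSubmodule A) hne).1 hmem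

variable (hA : A ≤ evenCentralizer α {y ⬝ᵥ e, x ⬝ᵥ e})
  (hO : ∀ i j, twoIndexSymmetry K x y e i j ∈ A)
include hA hO

theorem diracProjection_mem_of_mem_wordFiltration (hc : c ∈ evenPart α)
    (hcd : c ∈ wordFiltration (Set.range e) (1 : Submodule K R) d) :
    diracProjection α (y ⬝ᵥ e) (x ⬝ᵥ e) c ∈ A := by
  induction d generalizing c with
  | zero =>
    rw [(Submodule.mem_bot K).1 hcd, map_zero]
    exact zero_mem A
  | succ d ih =>
    rcases Nat.even_or_odd d with hd | hd
    · obtain rfl | hd0 := eq_or_ne d 0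
      · have hcA : c ∈ A := by
          have hle : wordFiltration (Set.range e) (1 : Submodule K R) 1 ≤ 1 :=
            wordFiltration_succ_le.2
              ⟨le_rfl, fun g _ w hw => by simp [(Submodule.mem_bot K).1 hw]⟩
          obtain ⟨r, rfl⟩ := Submodule.mem_one.1 (hle hcd)
          exact A.algebraMap_mem r
        rw [diracProjection_of_mem_evenCentralizer (hA hcA)]
        exact A.smul_mem hcA 2
      · exact h.diracProjection_mem_of_even hα hO hd hd0 (fun c' => ih) hc hcd
    · refine ih hc (mem_wordFiltration_of_odd (Set.forall_mem_range.2 hα.e) ?_ hd hcd hc)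
      intro b hb
      obtain ⟨r, rfl⟩ := Submodule.mem_one.1 hb
      exact α.commutes r

theorem diracProjection_mem_of_mem_mul {m : R}
    (hm : m ∈ Subalgebra.toSubmodule (Algebra.adjoin K (Set.range e) ⊓ evenPart α) *
      Subalgebra.toSubmodule A) :
    diracProjection α (y ⬝ᵥ e) (x ⬝ᵥ e) m ∈ A := by
  induction hm using Submodule.mul_induction_on' with
  | mem_mul_mem b hb a ha =>
    rw [diracProjection_mul_right (hA ha)]
    obtain ⟨d, hbd⟩ := exists_mem_wordFiltration (s := Set.range e) (B := (1 : Submodule K R))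
      (w := b) (by rw [mul_one]; exact hb.1)
    exact A.mul_mem (h.diracProjection_mem_of_mem_wordFiltration hα hA hO hb.2 hbd) ha
  | add m _ m' _ hm hm' => rw [map_add]; exact A.add_mem hm hm'

variable (hgen : Subalgebra.toSubmodule (Algebra.adjoin K (Set.range x ∪ Set.range y)) *
  Subalgebra.toSubmodule (Algebra.adjoin K (Set.range e)) = ⊤)
include hgen

theorem evenCentralizer_le : evenCentralizer α {y ⬝ᵥ e, x ⬝ᵥ e} ≤ A := by
  intro w hw
  have hcomm {v b : R} (hv : ∀ i, Commute (e i) v)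
      (hb : b ∈ Algebra.adjoin K (Set.range e) ⊓ evenPart α) : Commute v b :=
    Algebra.commute_of_mem_adjoin_of_forall_mem_commute hb.1
      (Set.forall_mem_range.2 fun i => (hv i).symm)
  have hwdot {f : ι → R} (hf : ∀ i j, Commute (e i) (f j)) (hff : ∀ i j, ⁅f i, f j⁆ = 0)
      (hfw : Commute (f ⬝ᵥ e) w) : ⁅f ⬝ᵥ f, w⁆ = 0 := by
    rw [← h.clifford.dotProduct_mul_self K hf hff, (hfw.mul_left hfw).lie_eq]
  have hx (i : ι) := fun b => hcomm (b := b) fun j => h.ex j i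
  have hy (i : ι) := fun b => hcomm (b := b) fun j => h.ey j i
  obtain ⟨d, hwd⟩ := exists_mem_wordFiltration (mem_mul_inf_evenPart hα.involutive
    (fun _ => hα.mem_evenPart_of_mem_adjoin) (fun _ => hα.map_mem_adjoin) hw.1
    (hgen ▸ Submodule.mem_top))
  have hw_mul : w ∈ Subalgebra.toSubmodule (Algebra.adjoin K (Set.range e) ⊓ evenPart α) *
      Subalgebra.toSubmodule A :=
    h.weyl.mem_of_lie_dotProduct_eq_zero hx hy
      (fun b hb => mul_one b ▸ Submodule.mul_mem_mul hb A.one_mem)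
      (fun i j m => angularMomentum_mul_mem hO hα.mul_mem_adjoin_inf_evenPart hx hy i j) hwd
      (hwdot h.ey h.weyl.lie_yy (commute_of_mem_evenCentralizer hw (by simp)))
      (hwdot h.ex h.weyl.lie_xx (commute_of_mem_evenCentralizer hw (by simp)))
  have hproj := h.diracProjection_mem_of_mem_mul hα hA hO hw_mul
  rw [diracProjection_of_mem_evenCentralizer hw] at hproj
  exact (Submodule.smul_mem_iff (Subalgebra.toSubmodule A) two_ne_zero).1 hproj

omit hA hO in
theorem evenCentralizer_eq_adjoin : evenCentralizer α {y ⬝ᵥ e, x ⬝ᵥ e} =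
    Algebra.adjoin K (Set.range fun p : ι × ι => twoIndexSymmetry K x y e p.1 p.2) := by
  have hadjoin : Algebra.adjoin K (Set.range fun p : ι × ι => twoIndexSymmetry K x y e p.1 p.2) ≤
      evenCentralizer α {y ⬝ᵥ e, x ⬝ᵥ e} :=
    Algebra.adjoin_le (Set.range_subset_iff.2 fun p =>
      h.twoIndexSymmetry_mem_evenCentralizer hα p.1 p.2)
  exact le_antisymm (h.evenCentralizer_le hα hadjoin
    (fun i j => Algebra.subset_adjoin ⟨(i, j), rfl⟩) hgen) hadjoin

end WeylCliffordRelations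
end Dirac

/-! ### Generators and relations of the Weyl-Clifford algebra -/

section Generators

theorem adjoin_image_eq_top {K M A : Type*} [CommRing K] [AddCommGroup M] [Module K M] [Ring A]
    [Algebra K A] {f : M →ₗ[K] A} (hf : Algebra.adjoin K (Set.range f) = ⊤) {s : Set M}
    (hs : Submodule.span K s = ⊤) : Algebra.adjoin K (f '' s) = ⊤ := by
  rw [← Algebra.adjoin_span, ← Submodule.map_span, hs, Submodule.map_top, LinearMap.coe_range, hf]

section TensorProduct

variable {K A B : Type*} [CommRing K] [Ring A] [Algebra K A] [Ring B] [Algebra K B]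

theorem adjoin_mul_adjoin_eq_top {s : Set A} {t : Set B} (hs : Algebra.adjoin K s = ⊤)
    (ht : Algebra.adjoin K t = ⊤) :
    Subalgebra.toSubmodule (Algebra.adjoin K ((· ⊗ₜ[K] (1 : B)) '' s)) *
      Subalgebra.toSubmodule (Algebra.adjoin K (((1 : A) ⊗ₜ[K] ·) '' t)) = ⊤ := by
  rw [eq_top_iff, ← TensorProduct.span_tmul_eq_top, Submodule.span_le]
  rintro _ ⟨a, b, rfl⟩
  rw [SetLike.mem_coe, ← mul_one a, ← one_mul b, ← Algebra.TensorProduct.tmul_mul_tmul]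
  refine Submodule.mul_mem_mul ?_ ?_
  · have ha := (Algebra.adjoin_image K (Algebra.TensorProduct.includeLeft : A →ₐ[K] A ⊗[K] B) s).ge
    exact ha ⟨a, hs ▸ Algebra.mem_top, rfl⟩
  · have hb := (Algebra.adjoin_image K (Algebra.TensorProduct.includeRight : B →ₐ[K] A ⊗[K] B) t).ge
    exact hb ⟨b, ht ▸ Algebra.mem_top, rfl⟩

end TensorProduct

theorem WeylCliffordRelations.tmul {K A B ι : Type*} [CommRing K] [Ring A] [Algebra K A] [Ring B]
    [Algebra K B] [DecidableEq ι] {x y : ι → A} {e : ι → B} (hxy : WeylRelations x y)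
    (he : CliffordRelations e) :
    WeylCliffordRelations (fun i => x i ⊗ₜ[K] (1 : B)) (fun i => y i ⊗ₜ[K] (1 : B))
      (fun i => (1 : A) ⊗ₜ[K] e i) where
  weyl :=
    { xx := fun i j => by simp [hxy.xx i j]
      yy := fun i j => by simp [hxy.yy i j]
      yx := fun i j => by
        rw [Algebra.TensorProduct.tmul_mul_tmul, hxy.yx, TensorProduct.add_tmul]
        split_ifs <;> simp [Algebra.TensorProduct.one_def] }
  clifford i j := by
    rw [Algebra.TensorProduct.tmul_mul_tmul, Algebra.TensorProduct.tmul_mul_tmul,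
      ← TensorProduct.tmul_add, mul_one, he]
    split_ifs
    · exact map_ofNat (Algebra.TensorProduct.includeRight : B →ₐ[K] A ⊗[K] B) 2
    · exact TensorProduct.tmul_zero _ _
  ex i j := by simp [commute_iff_eq]
  ey i j := by simp [commute_iff_eq]

section WeylAlgebra

variable {M : Type*} [AddCommGroup M] [Module ℂ M] (ω : LinearMap.BilinForm ℂ M)

theorem WeylAlgebra.lie_ι_ι (v v' : M) :
    ⁅WeylAlgebra.ι ω v, WeylAlgebra.ι ω v'⁆ = algebraMap ℂ (WeylAlgebra ω) (ω v v') := by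
  have hrel := RingQuot.mkAlgHom_rel ℂ (WeylRel.comm (ω := ω) v v')
  rw [map_sub, map_mul, map_mul, AlgHom.commutes] at hrel
  exact hrel

theorem WeylAlgebra.adjoin_range_ι : Algebra.adjoin ℂ (Set.range (WeylAlgebra.ι ω)) = ⊤ := by
  have hrange : Set.range (WeylAlgebra.ι ω) =
      RingQuot.mkAlgHom ℂ (WeylRel ω) '' Set.range (TensorAlgebra.ι ℂ) := by
    rw [← Set.range_comp]; rfl
  have hsurj := (AlgHom.range_eq_top _).2 (RingQuot.mkAlgHom_surjective ℂ (WeylRel ω))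
  rw [← Algebra.map_top, ← TensorAlgebra.adjoin_range_ι, AlgHom.map_adjoin, ← hrange] at hsurj
  exact hsurj

end WeylAlgebra

variable {V : Type*} [AddCommGroup V] [Module ℂ V]

theorem symplecticForm_apply (v v' : V × Module.Dual ℂ V) :
    symplecticForm V v v' = v'.2 v.1 - v.2 v'.1 := rfl

variable {σ : LinearMap.BilinForm ℂ V} {n : ℕ} (y : Module.Basis (Fin n) ℂ V)

theorem weylRelations_wx_wy : WeylRelations (wx y) (wy y) where
  xx i j := by
    rw [← commute_iff_eq, commute_iff_lie_eq, wx, wx, WeylAlgebra.lie_ι_ι, symplecticForm_apply]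
    simp
  yy i j := by
    rw [← commute_iff_eq, commute_iff_lie_eq, wy, wy, WeylAlgebra.lie_ι_ι, symplecticForm_apply]
    simp
  yx i j := by
    rw [← sub_eq_iff_eq_add', ← Ring.lie_def, wx, wy, WeylAlgebra.lie_ι_ι, symplecticForm_apply]
    simp [Finsupp.single_apply, apply_ite (algebraMap ℂ (WeylAlgebra (symplecticForm V)))]

theorem adjoin_wx_union_wy : Algebra.adjoin ℂ (Set.range (wx y) ∪ Set.range (wy y)) = ⊤ := by
  have hrange : Set.range (wx y) ∪ Set.range (wy y) =
      WeylAlgebra.ι (symplecticForm V) '' Set.range (y.prod y.dualBasis) := by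
    rw [← Set.range_comp, Set.union_comm, ← Set.Sum.elim_range]
    congr 1
    ext (i | i) <;> simp [wx, wy]
  rw [hrange]
  exact adjoin_image_eq_top (WeylAlgebra.adjoin_range_ι (symplecticForm V))
    (y.prod y.dualBasis).span_eq

theorem adjoin_ce : Algebra.adjoin ℂ (Set.range (ce σ y)) = ⊤ := by
  have himage := adjoin_image_eq_top (CliffordAlgebra.adjoin_range_ι (Q := σ.toQuadraticMap))
    y.span_eq
  rwa [← Set.range_comp] at himage

theorem cliffordRelations_ce (hy : ∀ i j, σ (y i) (y j) = if i = j then 1 else 0) :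
    CliffordRelations (ce σ y) := by
  intro i j
  rw [ce, ce, CliffordAlgebra.ι_mul_ι_add_swap, LinearMap.BilinMap.polar_toQuadraticMap, hy, hy]
  obtain rfl | hij := eq_or_ne i j
  · simp; norm_num
  · simp [hij, hij.symm]

variable (σ)

/-- The generator `x_i ⊗ 1` of the Weyl-Clifford algebra. -/
def genX (i : Fin n) : WeylCliff σ := wx y i ⊗ₜ[ℂ] 1

/-- The generator `y_i ⊗ 1` of the Weyl-Clifford algebra. -/
def genY (i : Fin n) : WeylCliff σ := wy y i ⊗ₜ[ℂ] 1

/-- The generator `1 ⊗ e_i` of the Weyl-Clifford algebra. -/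
def genE (i : Fin n) : WeylCliff σ := 1 ⊗ₜ[ℂ] ce σ y i

theorem dirac_eq_dotProduct : dirac σ y = genY σ y ⬝ᵥ genE σ y := by
  simp [dirac, dotProduct, genY, genE]

theorem diracDual_eq_dotProduct : diracDual σ y = genX σ y ⬝ᵥ genE σ y := by
  simp [diracDual, dotProduct, genX, genE]

theorem twoIndex_eq_twoIndexSymmetry (i j : Fin n) :
    twoIndex σ y i j = twoIndexSymmetry ℂ (genX σ y) (genY σ y) (genE σ y) i j := by
  simp [twoIndex, angMom, twoIndexSymmetry, angularMomentum, genX, genY, genE,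
    TensorProduct.sub_tmul]

theorem isParity_parity : IsParity (parity σ) (genX σ y) (genY σ y) (genE σ y) where
  involutive := parity_parity σ
  x i := by simp [parity, genX]
  y i := by simp [parity, genY]
  e i := by simp [parity, genE, ce, TensorProduct.tmul_neg]

theorem adjoin_genX_genY_mul_adjoin_genE :
    Subalgebra.toSubmodule (Algebra.adjoin ℂ (Set.range (genX σ y) ∪ Set.range (genY σ y))) *
      Subalgebra.toSubmodule (Algebra.adjoin ℂ (Set.range (genE σ y))) = ⊤ := by
  have htop := adjoin_mul_adjoin_eq_top (adjoin_wx_union_wy y) (adjoin_ce (σ := σ) y)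
  rwa [Set.image_union, ← Set.range_comp, ← Set.range_comp, ← Set.range_comp] at htop

variable {σ} in
theorem weylCliffordRelations_gen (hy : ∀ i j, σ (y i) (y j) = if i = j then 1 else 0) :
    WeylCliffordRelations (genX σ y) (genY σ y) (genE σ y) :=
  .tmul (weylRelations_wx_wy y) (cliffordRelations_ce y hy)

end Generators

/-! ### The total angular momentum algebra -/

section TotalAngularMomentum

variable {V : Type*} [AddCommGroup V] [Module ℂ V] {σ : LinearMap.BilinForm ℂ V}

theorem add_involute_mem_evenOdd_zero (c : Cliff σ) :
    c + CliffordAlgebra.involute c ∈ CliffordAlgebra.evenOdd σ.toQuadraticMap 0 := by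
  obtain ⟨c₀, hc₀, c₁, hc₁, rfl⟩ := Submodule.mem_sup.1
    ((CliffordAlgebra.evenOdd_isCompl σ.toQuadraticMap).sup_eq_top.ge (Submodule.mem_top (x := c)))
  rw [map_add, CliffordAlgebra.involute_eq_of_mem_even hc₀,
    CliffordAlgebra.involute_eq_of_mem_odd hc₁, add_add_add_comm, add_neg_cancel, add_zero]
  exact add_mem hc₀ hc₀

theorem add_parity_mem_gradedPart (a : WeylCliff σ) : a + parity σ a ∈ gradedPart σ 0 := by
  induction a using TensorProduct.induction_on with
  | zero => simp
  | add a b ha hb => rw [map_add, add_add_add_comm]; exact add_mem ha hb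
  | tmul w c =>
    refine ⟨w ⊗ₜ ⟨_, add_involute_mem_evenOdd_zero c⟩, ?_⟩
    simp [parity, TensorProduct.tmul_add]

theorem mem_gradedPart_zero_iff {a : WeylCliff σ} : a ∈ gradedPart σ 0 ↔ parity σ a = a := by
  refine ⟨fun ha => by simpa using parity_of_mem σ ha, fun ha => ?_⟩
  have htwo := add_parity_mem_gradedPart a
  rw [ha, ← two_smul ℂ] at htwo
  exact (Submodule.smul_mem_iff _ two_ne_zero).1 htwo

theorem superBracket_of_even {a : WeylCliff σ} (ha : parity σ a = a) (s : WeylCliff σ) :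
    superBracket σ s a = ⁅s, a⁆ := by
  have hodd : oddProj σ a = 0 := by simp [oddProj, ha]
  rw [superBracket, hodd, zero_mul, smul_zero, add_zero, Ring.lie_def]

theorem isLieSubSuperalgebra_centralizer {a : WeylCliff σ} (ha : parity σ a = a) :
    IsLieSubSuperalgebra σ (Subalgebra.toSubmodule (Subalgebra.centralizer ℂ {a})) := by
  set S := Subalgebra.centralizer ℂ {a}
  have hparity {s : WeylCliff σ} (hs : s ∈ S) : parity σ s ∈ S := by
    simp only [S, Subalgebra.mem_centralizer_iff, Set.mem_singleton_iff, forall_eq] at hs ⊢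
    rw [← ha, ← map_mul, ha, hs, map_mul, ha]
  have hodd {s : WeylCliff σ} (hs : s ∈ S) : oddProj σ s ∈ S :=
    S.smul_mem (S.sub_mem hs (hparity hs)) _
  exact ⟨fun s hs => hparity hs, fun s hs t ht =>
    S.add_mem (S.sub_mem (S.mul_mem hs ht) (S.mul_mem ht hs))
      (S.smul_mem (S.mul_mem (hodd ht) (hodd hs)) _)⟩

variable {n : ℕ} (y : Module.Basis (Fin n) ℂ V)

theorem dirac_mem_spo : dirac σ y ∈ spo σ y := Submodule.mem_sInf.2 fun _ hS => hS.2.1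

theorem diracDual_mem_spo : diracDual σ y ∈ spo σ y := Submodule.mem_sInf.2 fun _ hS => hS.2.2

theorem mem_tama_iff_of_even {a : WeylCliff σ} (ha : parity σ a = a) :
    a ∈ tama σ y ↔ a ∈ Subalgebra.centralizer ℂ {dirac σ y, diracDual σ y} := by
  have hcomm {s : WeylCliff σ} : superBracket σ s a = 0 ↔ s * a = a * s := by
    rw [superBracket_of_even ha, Ring.lie_def, sub_eq_zero]
  refine ⟨fun hmem => ?_, fun hmem s hs => ?_⟩
  · rintro s (rfl | rfl)
    · exact hcomm.1 (hmem _ (dirac_mem_spo y))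
    · exact hcomm.1 (hmem _ (diracDual_mem_spo y))
  · have hle : spo σ y ≤ Subalgebra.toSubmodule (Subalgebra.centralizer ℂ {a}) :=
      sInf_le ⟨isLieSubSuperalgebra_centralizer ha, by
        rintro _ rfl; exact (hmem _ (by simp)).symm, by rintro _ rfl; exact (hmem _ (by simp)).symm⟩
    exact hcomm.2 (hle hs a rfl).symm

theorem tamaEven_eq_evenCentralizer : tamaEven σ y =
    Subalgebra.toSubmodule (evenCentralizer (parity σ) {dirac σ y, diracDual σ y}) := by
  ext a
  refine ⟨fun ⟨hmem, heven⟩ => ?_, fun ⟨heven, hmem⟩ => ?_⟩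
  · have ha := mem_gradedPart_zero_iff.1 heven
    exact ⟨ha, (mem_tama_iff_of_even y ha).1 hmem⟩
  · exact ⟨(mem_tama_iff_of_even y heven).2 hmem, mem_gradedPart_zero_iff.2 heven⟩

variable (hy : ∀ i j, σ (y i) (y j) = if i = j then 1 else 0)

include hy in
theorem tamaEven_eq_adjoin : tamaEven σ y = Subalgebra.toSubmodule (Algebra.adjoin ℂ
    ((fun p : Fin n × Fin n => twoIndex σ y p.1 p.2) '' {p | p.1 < p.2})) := by
  have h := weylCliffordRelations_gen y hy
  rw [tamaEven_eq_evenCentralizer, dirac_eq_dotProduct, diracDual_eq_dotProduct,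
    h.evenCentralizer_eq_adjoin (isParity_parity σ y) (adjoin_genX_genY_mul_adjoin_genE σ y)]
  simp only [twoIndex_eq_twoIndexSymmetry]
  refine congrArg _ (le_antisymm (Algebra.adjoin_le (Set.range_subset_iff.2 fun p => ?_))
    (Algebra.adjoin_mono (Set.image_subset_range _ _)))
  exact h.twoIndexSymmetry_mem_adjoin_lt p.1 p.2

/-- The Lie algebra homomorphism from `so(n, ℂ)` to the total angular momentum algebra that sends
`X_ij` to `O_ij` for `i ≠ j`. -/
def soToTama : LieAlgebra.Orthogonal.so (Fin n) ℂ →ₗ⁅ℂ⁆ tama σ y where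
  toFun X := ⟨rotation (genX σ y) (genY σ y) (genE σ y) X.1, by
    have hX := (weylCliffordRelations_gen y hy).rotation_mem_evenCentralizer
      (isParity_parity σ y) ((LieAlgebra.Orthogonal.mem_so _ _ X.1).1 X.2)
    rw [← dirac_eq_dotProduct, ← diracDual_eq_dotProduct] at hX
    exact (mem_tama_iff_of_even y hX.1).2 hX.2⟩
  map_add' X Y := Subtype.ext (map_add (rotation _ _ _) X.1 Y.1)
  map_smul' r X := Subtype.ext (map_smul (rotation _ _ _) r X.1)
  map_lie' {X Y} := Subtype.ext ((weylCliffordRelations_gen y hy).lie_rotation_rotation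
    ((LieAlgebra.Orthogonal.mem_so _ _ X.1).1 X.2) Y.1).symm

theorem soToTama_soX {i j : Fin n} (hij : i ≠ j) :
    (soToTama y hy (soX i j) : WeylCliff σ) = twoIndex σ y i j := by
  rw [twoIndex_eq_twoIndexSymmetry, (weylCliffordRelations_gen y hy).twoIndexSymmetry_eq,
    if_neg hij, map_zero, add_zero]
  rfl

end TotalAngularMomentum

/-! ### Generators of the universal enveloping algebra -/

section EnvelopingAlgebra

theorem adjoin_range_universalEnvelopingAlgebra_ι (K L : Type*) [CommRing K] [LieRing L]
    [LieAlgebra K L] : Algebra.adjoin K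
      (Set.range (UniversalEnvelopingAlgebra.ι K : L → UniversalEnvelopingAlgebra K L)) = ⊤ := by
  set S := Algebra.adjoin K
    (Set.range (UniversalEnvelopingAlgebra.ι K : L → UniversalEnvelopingAlgebra K L))
  let ιS : L →ₗ⁅K⁆ S :=
    { toFun := fun X => ⟨UniversalEnvelopingAlgebra.ι K X, Algebra.subset_adjoin ⟨X, rfl⟩⟩
      map_add' := fun X Y => Subtype.ext (map_add _ X Y)
      map_smul' := fun r X => Subtype.ext (map_smul _ r X)
      map_lie' := fun {X Y} => Subtype.ext (LieHom.map_lie _ X Y) }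
  have hid : S.val.comp (UniversalEnvelopingAlgebra.lift K ιS) = AlgHom.id K _ :=
    UniversalEnvelopingAlgebra.hom_ext K (LieHom.ext fun X =>
      congrArg S.val (UniversalEnvelopingAlgebra.lift_ι_apply K ιS X))
  refine eq_top_iff.2 fun u _ => ?_
  rw [← AlgHom.id_apply (R := K) u, ← hid]
  exact (UniversalEnvelopingAlgebra.lift K ιS u).2

variable {n : ℕ}

theorem soX_swap (i j : Fin n) : soX j i = -soX i j := Subtype.ext (neg_sub _ _).symm

theorem two_smul_eq_sum_soX (X : LieAlgebra.Orthogonal.so (Fin n) ℂ) :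
    (2 : ℂ) • X = ∑ i, ∑ j, X.1 i j • soX i j := by
  have hsum (Y : Matrix (Fin n) (Fin n) ℂ) :
      Y = ∑ i, ∑ j, Y i j • Matrix.single i j (1 : ℂ) := by
    simpa using Matrix.matrix_eq_sum_single Y
  have htranspose : X.1ᵀ = ∑ i, ∑ j, X.1 i j • Matrix.single j i (1 : ℂ) := by
    rw [hsum X.1ᵀ, Finset.sum_comm]; rfl
  refine Subtype.ext (Eq.trans (b := X.1 - X.1ᵀ) ?_ ?_)
  · rw [(LieAlgebra.Orthogonal.mem_so _ _ X.1).1 X.2, sub_neg_eq_add, ← two_smul ℂ]; rfl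
  · rw [htranspose]
    nth_rewrite 1 [hsum X.1]
    simp [soX, smul_sub, Finset.sum_sub_distrib]

theorem span_soX :
    Submodule.span ℂ ((fun p : Fin n × Fin n => soX p.1 p.2) '' {p | p.1 < p.2}) = ⊤ := by
  set S := Submodule.span ℂ ((fun p : Fin n × Fin n => soX p.1 p.2) '' {p | p.1 < p.2})
  have hlt {i j : Fin n} (hij : i < j) : soX i j ∈ S := Submodule.subset_span ⟨(i, j), hij, rfl⟩
  have hmem (i j : Fin n) : soX i j ∈ S := by
    obtain hij | rfl | hji := lt_trichotomy i j
    · exact hlt hij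
    · exact (show soX i i = 0 from Subtype.ext (sub_self _)) ▸ S.zero_mem
    · exact soX_swap j i ▸ S.neg_mem (hlt hji)
  refine eq_top_iff.2 fun X _ => (S.smul_mem_iff (two_ne_zero (α := ℂ))).1 ?_
  rw [two_smul_eq_sum_soX]
  exact sum_mem fun i _ => sum_mem fun j _ => S.smul_mem _ (hmem i j)

theorem adjoin_ι_soX :
    Algebra.adjoin ℂ ((fun p : Fin n × Fin n => UniversalEnvelopingAlgebra.ι ℂ (soX p.1 p.2)) ''
      {p | p.1 < p.2}) = ⊤ := by
  have himage := adjoin_image_eq_top (f := (UniversalEnvelopingAlgebra.ι ℂ :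
    LieAlgebra.Orthogonal.so (Fin n) ℂ →ₗ⁅ℂ⁆ _).toLinearMap)
    (adjoin_range_universalEnvelopingAlgebra_ι ℂ _) span_soX
  rwa [← Set.image_comp] at himage

end EnvelopingAlgebra

end AngularMomentum

end

open AngularMomentum in
theorem mainTheorem3 {V : Type*} [AddCommGroup V] [Module ℂ V]
    (σ : LinearMap.BilinForm ℂ V) (n : ℕ) (y : Module.Basis (Fin n) ℂ V)
    (hy : ∀ i j, σ (y i) (y j) = if i = j then 1 else 0) :
    ∃ φ : UniversalEnvelopingAlgebra ℂ (LieAlgebra.Orthogonal.so (Fin n) ℂ) →ₐ[ℂ] tama σ y,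
      (∀ i j : Fin n, i < j →
        (φ (UniversalEnvelopingAlgebra.ι ℂ (soX i j)) : WeylCliff σ) = twoIndex σ y i j) ∧
      (∀ ψ : UniversalEnvelopingAlgebra ℂ (LieAlgebra.Orthogonal.so (Fin n) ℂ) →ₐ[ℂ] tama σ y,
        (∀ i j : Fin n, i < j →
          (ψ (UniversalEnvelopingAlgebra.ι ℂ (soX i j)) : WeylCliff σ) = twoIndex σ y i j) →
        ψ = φ) ∧
      Subalgebra.toSubmodule (φ.range.map (tama σ y).val) = tamaEven σ y := by
  let φ := UniversalEnvelopingAlgebra.lift ℂ (soToTama y hy)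
  have hφ (i j : Fin n) (hij : i < j) :
      (φ (UniversalEnvelopingAlgebra.ι ℂ (soX i j)) : WeylCliff σ) = twoIndex σ y i j := by
    rw [UniversalEnvelopingAlgebra.lift_ι_apply, soToTama_soX y hy hij.ne]
  refine ⟨φ, hφ, fun ψ hψ => AlgHom.ext_of_adjoin_eq_top adjoin_ι_soX ?_, ?_⟩
  · rintro _ ⟨⟨i, j⟩, hij, rfl⟩
    exact Subtype.ext ((hψ i j hij).trans (hφ i j hij).symm)
  · rw [tamaEven_eq_adjoin y hy, ← Algebra.map_top, Subalgebra.map_map, ← adjoin_ι_soX,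
      AlgHom.map_adjoin, ← Set.image_comp]
    exact congrArg _ (congrArg _ (Set.image_congr fun p hp => hφ p.1 p.2 hp))
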